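/- Let $F$ be a nonarchimedean local field, $\theta$ a nontrivial (continuous complex) character of $(F,+)$, and $G_n = GL(n,F)$. For $n\ge 2$ let $U_n\subset G_n$ be the group of matrices $u(x)=\begin{pmatrix} I_{n-1} & x\\ 0 & 1\end{pmatrix}$, $x\in F^{n-1}$, embed $G_{n-1}$ in $G_n$ by $g\mapsto \mathrm{diag}(g,1)$, and put $P_n=G_{n-1}U_n$; put $P_1=\{1\}$. Let $\delta_{U_n}$ be the modulus character of $G_{n-1}$ acting on $U_n$: $\int_{U_n} f(a^{-1}ua)\,du=\delta_{U_n}(a)\int_{U_n} f(u)\,du$ for a Haar measure $du$. For a complex representation $\sigma$ of $P_{n-1}$ on a vector space $V$, let $\Phi^+\sigma = \mathrm{ind}_{P_{n-1}U_n}^{P_n}(\delta_{U_n}^{1/2}\sigma\otimes\theta)$ (compact induction), i.e. the space of functions $f:P_n\to V$ which are right invariant under an open subgroup, have compact support modulo $P_{n-1}U_n$, and satisfy $f(b\,u(x)\,g)=\delta_{U_n}(b)^{1/2}\,\theta(x_{n-1})\,\sigma(b)f(g)$ for $b\in P_{n-1}$, $x\in F^{n-1}$, $g\in P_n$, with $P_n$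 acting by right translation. Let $n=p+q$ with $p\ge q\ge 1$. Let $w_{p,q}$ be the permutation of $\{1,\dots,n\}$ given by $i\mapsto i$ for $i\le p-q$, and $p-q+j\mapsto p-q+2j-1$, $p+j\mapsto p-q+2j$ for $1\le j\le q$; it fixes $n$, and $w_{p,q-1}$ denotes its restriction to $\{1,\dots,n-1\}$. Identify a permutation $w$ with the matrix sending the basis vector $e_j$ to $e_{w(j)}$. Let $H_{p,q}=w_{p,q}M_{(p,q)}w_{p,q}^{-1}\subset G_n$ and $H_{p,q-1}=w_{p,q-1}M_{(p,q-1)}w_{p,q-1}^{-1}\subset G_{n-1}$, where $M_{(a,b)}$ is the group of block diagonal matrices $\mathrm{diag}(h_a,h_b)$ with $h_a\in G_a$, $h_b\in G_b$. A positive character is a continuous homomorphism to $\mathbb{R}_{>0}$, and for a representation $\rho$ and a character $\chi$ of a group $K$, $\mathrm{Hom}_K(\rho,\chi)$ is the space of linear forms $\lambda$ with $\lambda(\rho(k)v)=\chi(k)\lambda(v)$ for all $k\in K$ and all $v$. Let $\sigma$ be a smooth complex representation of $P_{n-1}$ and let $\chi$ be a positive character of $P_n\cap H_{p,q}$. Then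 there are a positive character $\chi'$ of $P_{n-1}\cap H_{p,q-1}$ and an injective linear map $$\mathrm{Hom}_{P_n\cap H_{p,q}}(\Phi^+\sigma,\chi)\hookrightarrow \mathrm{Hom}_{P_{n-1}\cap H_{p,q-1}}(\sigma,\chi').$$ -/

import Mathlib

open scoped Matrix NNReal

namespace GLDist

/-! ### Smooth representations, characters and compact induction -/

section General

variable {G : Type*} [Group G] [TopologicalSpace G]

/-- A complex representation is smooth if the stabilizer of every vector is open. -/
def IsSmoothRep {V : Type*} [AddCommGroup V] [Module ℂ V] (ρ : Representation ℂ G V) : Prop :=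
  ∀ v : V, IsOpen {g : G | ρ g v = v}

/-- A positive character: a continuous homomorphism to the group of positive reals. -/
abbrev PositiveCharacter (G : Type*) [Group G] [TopologicalSpace G] :=
  G →ₜ* {x : ℝ // 0 < x}

/-- For subgroups `P`, `H` of `G`, a representation `ρ` of `P` on `V` and a character `χ` of
`P ∩ H`, the space `Hom_{P ∩ H}(ρ, χ)` of linear forms `l` on `V` such that
`l (ρ h v) = χ h * l v` for all `h` in `P ∩ H`. -/
def homChar {P : Subgroup G} {V : Type*} [AddCommGroup V] [Module ℂ V]
    (ρ : Representation ℂ P V) (H : Subgroup G)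
    (χ : PositiveCharacter (P ⊓ H : Subgroup G)) : Submodule ℂ (V →ₗ[ℂ] ℂ) where
  carrier := {l | ∀ (h : (P ⊓ H : Subgroup G)) (v : V),
    l (ρ ⟨h.1, h.2.1⟩ v) = (((χ h : {x : ℝ // 0 < x}) : ℝ) : ℂ) * l v}
  add_mem' := by
    intro a b ha hb h v
    simp only [LinearMap.add_apply, ha h v, hb h v, mul_add]
  zero_mem' := by
    intro h v
    simp
  smul_mem' := by
    intro c a ha h v
    simp only [LinearMap.smul_apply, ha h v, smul_eq_mul]
    ring

/-- The space of the compact induction `ind_H^G ρ`: functions `f : G → W` with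
`f (h g) = ρ h (f g)` for `h` in `H`, which are right invariant under some open subgroup of `G`
(in a locally compact totally disconnected group, every open subgroup contains a compact open
one), and whose support is compact modulo `H`, i.e. contained in `H C` for a compact `C`. -/
def cIndSpace (H : Subgroup G) {W : Type*} [AddCommGroup W] [Module ℂ W]
    (ρ : Representation ℂ H W) : Submodule ℂ (G → W) where
  carrier := {f | (∀ (h : H) (g : G), f (h * g) = ρ h (f g)) ∧
    (∃ K : OpenSubgroup G, ∀ k ∈ K, ∀ g : G, f (g * k) = f g) ∧
    (∃ C : Set G, IsCompact C ∧ ∀ g : G, f g ≠ 0 → ∃ h : H, ∃ c ∈ C, g = h * c)}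
  add_mem' := by
    rintro a b ⟨ha, ⟨K, hK⟩, C, hC, haC⟩ ⟨hb, ⟨L, hL⟩, D, hD, hbD⟩
    refine ⟨fun h g => ?_, ⟨K ⊓ L, fun k hk g => ?_⟩, C ∪ D, hC.union hD, fun g hg => ?_⟩
    · simp only [Pi.add_apply, ha, hb, map_add]
    · simp only [Pi.add_apply, hK k hk.1 g, hL k hk.2 g]
    · by_cases h0 : a g = 0
      · have h1 : b g ≠ 0 := fun h1 => hg (by simp [h0, h1])
        obtain ⟨h, c, hc, e⟩ := hbD g h1
        exact ⟨h, c, Or.inr hc, e⟩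
      · obtain ⟨h, c, hc, e⟩ := haC g h0
        exact ⟨h, c, Or.inl hc, e⟩
  zero_mem' :=
    ⟨fun h g => by simp, ⟨⊤, fun k _ g => rfl⟩, ∅, isCompact_empty, fun g hg => (hg rfl).elim⟩
  smul_mem' := by
    rintro z a ⟨ha, ⟨K, hK⟩, C, hC, haC⟩
    refine ⟨fun h g => ?_, ⟨K, fun k hk g => ?_⟩, C, hC, fun g hg => haC g fun h0 => hg ?_⟩
    · simp only [Pi.smul_apply, ha, map_smul]
    · simp only [Pi.smul_apply, hK k hk g]
    · simp [h0]

variable [IsTopologicalGroup G]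

theorem cIndSpace_translate (H : Subgroup G) {W : Type*} [AddCommGroup W] [Module ℂ W]
    (ρ : Representation ℂ H W) (x : G) {f : G → W} (hf : f ∈ cIndSpace H ρ) :
    (fun g => f (g * x)) ∈ cIndSpace H ρ := by
  obtain ⟨h1, ⟨K, hK⟩, C, hC, hfC⟩ := hf
  refine ⟨fun h g => ?_, ⟨K.comap (MulAut.conj x⁻¹).toMonoidHom ?_, fun k hk g => ?_⟩,
    (fun c => c * x⁻¹) '' C, hC.image (by fun_prop), fun g hg => ?_⟩
  · simp only [mul_assoc, h1]
  · change Continuous fun g : G => x⁻¹ * g * (x⁻¹)⁻¹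
    fun_prop
  · have hk' : x⁻¹ * k * (x⁻¹)⁻¹ ∈ K := hk
    have := hK _ hk' (g * x)
    simpa [mul_assoc] using this
  · obtain ⟨h, c, hc, e⟩ := hfC _ hg
    exact ⟨h, c * x⁻¹, ⟨c, hc, rfl⟩, by rw [← mul_assoc, ← e, mul_inv_cancel_right]⟩

/-- The compact induction `ind_H^G ρ`, on which `G` acts by right translation. -/
def cInd (H : Subgroup G) {W : Type*} [AddCommGroup W] [Module ℂ W]
    (ρ : Representation ℂ H W) : Representation ℂ G (cIndSpace H ρ) where
  toFun x :=
    { toFun := fun f => ⟨fun g => f.1 (g * x), cIndSpace_translate H ρ x f.2⟩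
      map_add' := fun _ _ => rfl
      map_smul' := fun _ _ => rfl }
  map_one' := by
    ext f g
    simp
  map_mul' x y := by
    ext f g
    simp [mul_assoc]

end General

/-! ### Subgroups of `GL_n` -/

section Groups

variable {F : Type*} [Field F]

/-- The embedding `(a, b) ↦ diag (a, b)` of `GL_p × GL_q` in `GL_n`, for `p + q = n`. -/
def diagHom (F : Type*) [Field F] {p q n : ℕ} (h : p + q = n) :
    GL (Fin p) F × GL (Fin q) F →* GL (Fin n) F :=
  MonoidHom.toHomUnits
    { toFun := fun x => Matrix.reindex (finSumFinEquiv.trans (finCongr h))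
        (finSumFinEquiv.trans (finCongr h)) (Matrix.fromBlocks x.1.val 0 0 x.2.val)
      map_one' := by
        simp only [Prod.fst_one, Prod.snd_one, Units.val_one, Matrix.fromBlocks_one,
          Matrix.reindex_apply, Matrix.submatrix_one_equiv]
      map_mul' := fun x y => by
        simp only [Prod.fst_mul, Prod.snd_mul, Units.val_mul, Matrix.reindex_apply,
          Matrix.submatrix_mul_equiv, Matrix.fromBlocks_multiply, Matrix.zero_mul,
          Matrix.mul_zero, add_zero, zero_add] }

/-- The embedding `g ↦ diag (g, 1)` of `GL_m` in `GL_{m+1}`. -/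
def emb {m : ℕ} : GL (Fin m) F →* GL (Fin (m + 1)) F :=
  (diagHom F (p := m) (q := 1) rfl).comp (MonoidHom.inl _ _)

/-- The matrix `u(x) = (I_m x; 0 1)` of `GL_{m+1}`, for a column vector `x` in `F^m`. -/
def uMat {m : ℕ} (x : Fin m → F) : Matrix (Fin (m + 1)) (Fin (m + 1)) F :=
  Matrix.reindex finSumFinEquiv finSumFinEquiv
    (Matrix.fromBlocks 1 (Matrix.of fun i (_ : Fin 1) => x i) 0 1)

theorem uMat_mul {m : ℕ} (x y : Fin m → F) : uMat x * uMat y = uMat (x + y) := by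
  simp only [uMat, Matrix.reindex_apply, Matrix.submatrix_mul_equiv, Matrix.fromBlocks_multiply]
  congr 2
  · simp
  · ext i j; simp [add_comm]
  · simp
  · simp

theorem uMat_zero {m : ℕ} : uMat (0 : Fin m → F) = 1 := by
  have : (Matrix.of fun (i : Fin m) (_ : Fin 1) => (0 : Fin m → F) i) = 0 := by ext; simp
  rw [uMat, this, Matrix.fromBlocks_one]
  simp

/-- `u(x)` as an element of `GL_{m+1}`. -/
def u {m : ℕ} (x : Fin m → F) : GL (Fin (m + 1)) F where
  val := uMat x
  inv := uMat (-x)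
  val_inv := by rw [uMat_mul, add_neg_cancel, uMat_zero]
  inv_val := by rw [uMat_mul, neg_add_cancel, uMat_zero]

theorem u_mul {m : ℕ} (x y : Fin m → F) : u x * u y = u (x + y) :=
  Units.ext (uMat_mul x y)

theorem u_zero {m : ℕ} : u (0 : Fin m → F) = 1 := Units.ext uMat_zero

theorem emb_val {m : ℕ} (a : GL (Fin m) F) : (emb a : GL (Fin (m + 1)) F).val =
    Matrix.reindex finSumFinEquiv finSumFinEquiv
      (Matrix.fromBlocks a.val 0 0 (1 : Matrix (Fin 1) (Fin 1) F)) := rfl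

/-- `diag (a, 1) u(x) = u(a x) diag (a, 1)`. -/
theorem emb_mul_u {m : ℕ} (a : GL (Fin m) F) (x : Fin m → F) :
    emb a * u x = u (a.val *ᵥ x) * emb a := by
  apply Units.ext
  simp only [Units.val_mul, emb_val, u, uMat, Matrix.reindex_apply, Matrix.submatrix_mul_equiv,
    Matrix.fromBlocks_multiply]
  congr 2
  · simp
  · ext i j; simp [Matrix.mul_apply, Matrix.mulVec, dotProduct]
  · simp
  · simp

/-- The subgroup `P_{m+1} = GL_m U_{m+1}` of `GL_{m+1}`, the set of products `diag (a, 1) u(x)`. -/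
def mirabolic (F : Type*) [Field F] (m : ℕ) : Subgroup (GL (Fin (m + 1)) F) where
  carrier := {g | ∃ (a : GL (Fin m) F) (x : Fin m → F), g = emb a * u x}
  one_mem' := ⟨1, 0, by rw [map_one, u_zero, one_mul]⟩
  mul_mem' := by
    rintro _ _ ⟨a, x, rfl⟩ ⟨b, y, rfl⟩
    refine ⟨a * b, (b⁻¹).val *ᵥ x + y, ?_⟩
    have h := emb_mul_u b ((b⁻¹).val *ᵥ x)
    rw [Matrix.mulVec_mulVec, ← Units.val_mul, mul_inv_cancel, Units.val_one,
      Matrix.one_mulVec] at h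
    rw [map_mul, ← u_mul, mul_assoc, mul_assoc, ← mul_assoc (u x), ← h, mul_assoc]
  inv_mem' := by
    rintro _ ⟨a, x, rfl⟩
    refine ⟨a⁻¹, a.val *ᵥ (-x), ?_⟩
    have h : (u x)⁻¹ = u (-x) := by
      rw [inv_eq_iff_mul_eq_one, u_mul, add_neg_cancel, u_zero]
    have h2 := emb_mul_u a (-x)
    rw [mul_inv_rev, h, map_inv, eq_inv_mul_iff_mul_eq, ← mul_assoc, h2, mul_inv_cancel_right]

/-- The upper left `m × m` block of a matrix of size `m + 1`. -/
def topLeft {m : ℕ} (g : Matrix (Fin (m + 1)) (Fin (m + 1)) F) : Matrix (Fin m) (Fin m) F :=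
  g.submatrix Fin.castSucc Fin.castSucc

theorem emb_mul_u_val {m : ℕ} (a : GL (Fin m) F) (x : Fin m → F) :
    (emb a * u x).val = Matrix.reindex finSumFinEquiv finSumFinEquiv
      (Matrix.fromBlocks a.val (Matrix.of fun i (_ : Fin 1) => (a.val *ᵥ x) i) 0 1) := by
  simp only [Units.val_mul, emb_val, u, uMat, Matrix.reindex_apply, Matrix.submatrix_mul_equiv,
    Matrix.fromBlocks_multiply]
  congr 2
  · simp
  · ext i j; simp [Matrix.mul_apply, Matrix.mulVec, dotProduct]
  · simp
  · simp

theorem topLeft_emb_mul_u {m : ℕ} (a : GL (Fin m) F) (x : Fin m → F) :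
    topLeft (emb a * u x).val = a.val := by
  rw [emb_mul_u_val]
  ext i j
  have h (i : Fin m) : finSumFinEquiv.symm (Fin.castSucc i) = (Sum.inl i : Fin m ⊕ Fin 1) := by
    rw [Equiv.symm_apply_eq]; rfl
  simp [topLeft, h]

theorem lastCol_emb_mul_u {m : ℕ} (a : GL (Fin m) F) (x : Fin m → F) (i : Fin m) :
    (emb a * u x).val i.castSucc (Fin.last m) = (a.val *ᵥ x) i := by
  rw [emb_mul_u_val]
  have h (i : Fin m) : finSumFinEquiv.symm (Fin.castSucc i) = (Sum.inl i : Fin m ⊕ Fin 1) := by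
    rw [Equiv.symm_apply_eq]; rfl
  have h' : finSumFinEquiv.symm (Fin.last m) = (Sum.inr 0 : Fin m ⊕ Fin 1) := by
    rw [Equiv.symm_apply_eq]; rfl
  simp [h, h']

theorem lastRow_emb_mul_u {m : ℕ} (a : GL (Fin m) F) (x : Fin m → F) (j : Fin (m + 1)) :
    (emb a * u x).val (Fin.last m) j = if j = Fin.last m then 1 else 0 := by
  rw [emb_mul_u_val]
  have h (i : Fin m) : finSumFinEquiv.symm (Fin.castSucc i) = (Sum.inl i : Fin m ⊕ Fin 1) := by
    rw [Equiv.symm_apply_eq]; rfl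
  have h' : finSumFinEquiv.symm (Fin.last m) = (Sum.inr 0 : Fin m ⊕ Fin 1) := by
    rw [Equiv.symm_apply_eq]; rfl
  induction j using Fin.lastCases with
  | last => simp [h']
  | cast j => simp [h, h', Fin.castSucc_ne_last]

theorem topLeft_mul {m : ℕ} (g h : mirabolic F m) :
    topLeft (g * h).1.val = topLeft g.1.val * topLeft h.1.val := by
  obtain ⟨_, b, y, rfl⟩ := h
  ext i j
  have := lastRow_emb_mul_u b y j.castSucc
  rw [if_neg (Fin.castSucc_ne_last j)] at this
  simp only [topLeft, Subgroup.coe_mul, Units.val_mul, Matrix.submatrix_apply, Matrix.mul_apply,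
    Fin.sum_univ_castSucc] at this ⊢
  rw [this]
  simp

/-- The homomorphism `diag (a, 1) u(x) ↦ a` from `P_{m+1}` to `GL_m`. -/
def levi {m : ℕ} : mirabolic F m →* GL (Fin m) F :=
  MonoidHom.toHomUnits
    { toFun := fun g => topLeft g.1.val
      map_one' := by
        ext i j
        simp [topLeft, Matrix.one_apply]
      map_mul' := topLeft_mul }

theorem levi_emb_mul_u {m : ℕ} (a : GL (Fin m) F) (x : Fin m → F) :
    levi (⟨emb a * u x, a, x, rfl⟩ : mirabolic F m) = a :=
  Units.ext (topLeft_emb_mul_u a x)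

/-- The standard Levi subgroup `M_{(p,q)}` of `GL_n`, where `p + q = n`. -/
def stdLevi (F : Type*) [Field F] {p q n : ℕ} (h : p + q = n) : Subgroup (GL (Fin n) F) :=
  (diagHom F h).range

/-- The permutation `w_{p,q}`, on indices starting from `0` and with `d = p - q`: it fixes
`0, …, d - 1` and sends `d + j` to `d + 2 j` and `p + j` to `d + 2 j + 1`. -/
def wFun (p q a : ℕ) : ℕ :=
  if a < p - q then a
  else if a < p then (p - q) + 2 * (a - (p - q))
  else (p - q) + 2 * (a - p) + 1

theorem wFun_lt {p q n a : ℕ} (hqp : q ≤ p) (hn : n = p + q ∨ n + 1 = p + q) (ha : a < n) :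
    wFun p q a < n := by
  unfold wFun
  split_ifs <;> omega

theorem wFun_inj {p q a b : ℕ} (h : wFun p q a = wFun p q b) : a = b := by
  unfold wFun at h
  split_ifs at h <;> omega

/-- `w_{p,q}` as a permutation of the first `n` indices, for `n = p + q` (this is `w_{p,q}`
itself) and for `n = p + q - 1` (this is `w_{p,q-1}`, the restriction of `w_{p,q}`). -/
noncomputable def wPerm {p q n : ℕ} (hqp : q ≤ p) (hn : n = p + q ∨ n + 1 = p + q) :
    Equiv.Perm (Fin n) :=
  Equiv.ofBijective (fun a => ⟨wFun p q a, wFun_lt hqp hn a.2⟩)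
    (Finite.injective_iff_bijective.mp fun _ _ h => Fin.ext (wFun_inj (Fin.ext_iff.mp h)))

/-- The permutation matrix of `w`, which sends the basis vector `e_j` to `e_{w j}`. -/
def permGL (F : Type*) [Field F] {n : ℕ} (w : Equiv.Perm (Fin n)) : GL (Fin n) F :=
  MonoidHom.toHomUnits (Matrix.permMatrixHom (n := Fin n) (R := F)) w

/-- The subgroup `H_{p,q} = w_{p,q} M_{(p,q)} w_{p,q}⁻¹` of `GL_n`, where `n = p + q`. -/
noncomputable def Hpq (F : Type*) [Field F] {p q n : ℕ} (hqp : q ≤ p) (hn : p + q = n) :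
    Subgroup (GL (Fin n) F) :=
  (stdLevi F hn).map
    (MulAut.conj (permGL F (wPerm hqp (Or.inl hn.symm)))).toMonoidHom

/-- The subgroup `H_{p,q-1} = w_{p,q-1} M_{(p,q-1)} w_{p,q-1}⁻¹` of `GL_n`, where
`n = p + (q - 1)` and `q ≥ 1`. -/
noncomputable def Hpq' (F : Type*) [Field F] {p q n : ℕ} (hq : 1 ≤ q) (hqp : q ≤ p)
    (hn : p + (q - 1) = n) : Subgroup (GL (Fin n) F) :=
  (stdLevi F hn).map
    (MulAut.conj (permGL F (wPerm (p := p) (q := q) hqp (Or.inr (by omega))))).toMonoidHom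

/-- The subgroup `P_{m+1} U_{m+2}` of `P_{m+2}`. -/
def PU (F : Type*) [Field F] (m : ℕ) : Subgroup (mirabolic F (m + 1)) :=
  (mirabolic F m).comap levi

theorem mem_PU {m : ℕ} (g : mirabolic F (m + 1)) :
    g ∈ PU F m ↔ ∃ b ∈ mirabolic F m, ∃ x, g.1 = emb b * u x := by
  obtain ⟨_, a, y, rfl⟩ := g
  rw [PU, Subgroup.mem_comap, levi_emb_mul_u]
  refine ⟨fun h => ⟨a, h, y, rfl⟩, ?_⟩
  rintro ⟨b, hb, x, e⟩
  have h := congrArg topLeft (congrArg Units.val e)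
  rw [topLeft_emb_mul_u, topLeft_emb_mul_u] at h
  rwa [Units.ext h]

/-- The projection `diag (b, 1) u(x) ↦ b` from `P_{m+1} U_{m+2}` to `P_{m+1}`. -/
def projP {m : ℕ} : PU F m →* mirabolic F m := levi.subgroupComap (mirabolic F m)

/-- The function `diag (b, 1) u(x) ↦ θ(x_{m+1})` on `P_{m+1} U_{m+2}`: it is given by `θ` applied
to the entry just above the lower right corner. -/
def thetaPU (θ : AddChar F ℂ) {m : ℕ} (g : PU F m) : ℂ :=
  θ (g.1.1.val (Fin.last m).castSucc (Fin.last (m + 1)))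

theorem mulVec_last {m : ℕ} {b : GL (Fin (m + 1)) F} (hb : b ∈ mirabolic F m)
    (x : Fin (m + 1) → F) : (b.val *ᵥ x) (Fin.last m) = x (Fin.last m) := by
  obtain ⟨a, y, rfl⟩ := hb
  simp [Matrix.mulVec, dotProduct, lastRow_emb_mul_u]

theorem thetaPU_emb_mul_u (θ : AddChar F ℂ) {m : ℕ} (b : GL (Fin (m + 1)) F)
    (hb : b ∈ mirabolic F m) (x : Fin (m + 1) → F) (h) :
    thetaPU θ (⟨⟨emb b * u x, b, x, rfl⟩, h⟩ : PU F m) = θ (x (Fin.last m)) := by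
  rw [thetaPU, lastCol_emb_mul_u, mulVec_last hb]

theorem thetaPU_one (θ : AddChar F ℂ) {m : ℕ} : thetaPU θ (1 : PU F m) = 1 := by
  have : (Fin.last m).castSucc ≠ Fin.last (m + 1) := Fin.castSucc_ne_last _
  simp [thetaPU, this]

theorem thetaPU_mul (θ : AddChar F ℂ) {m : ℕ} (g h : PU F m) :
    thetaPU θ (g * h) = thetaPU θ g * thetaPU θ h := by
  obtain ⟨⟨_, a, x, rfl⟩, hg⟩ := g
  obtain ⟨⟨_, b, y, rfl⟩, hh⟩ := h
  have ha : a ∈ mirabolic F m := by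
    rwa [PU, Subgroup.mem_comap, levi_emb_mul_u] at hg
  rw [thetaPU, thetaPU, thetaPU, ← AddChar.map_add_eq_mul]
  congr 1
  have key (j : Fin (m + 1)) : (emb a * u x).val (Fin.last m).castSucc j.castSucc =
      if j = Fin.last m then 1 else 0 := by
    have h1 := congrFun (congrFun (topLeft_emb_mul_u a x) (Fin.last m)) j
    obtain ⟨c, z, rfl⟩ := ha
    rw [lastRow_emb_mul_u] at h1
    exact h1
  have key2 : (emb b * u y).val (Fin.last (m + 1)) (Fin.last (m + 1)) = 1 := by
    rw [lastRow_emb_mul_u, if_pos rfl]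
  simp only [Subgroup.coe_mul, Units.val_mul (emb a * u x)] at key key2 ⊢
  rw [Matrix.mul_apply, Fin.sum_univ_castSucc, key2]
  simp only [key]
  simp [add_comm]

end Groups

/-! ### The functor `Φ⁺` -/

section Functor

variable {F : Type*} [Field F] [ValuativeRel F] [TopologicalSpace F]
  [IsNonarchimedeanLocalField F]

/-- The automorphism `x ↦ a x` of the topological group `F^m`; under the identification
`x ↦ u(x)` of `F^m` with `U_{m+1}` it is conjugation by `diag (a, 1)`. -/
def mulVecEquiv {m : ℕ} (a : GL (Fin m) F) : (Fin m → F) ≃ₜ+ (Fin m → F) where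
  toFun x := a.val *ᵥ x
  invFun x := (a⁻¹).val *ᵥ x
  left_inv x := by
    change (a⁻¹).val *ᵥ (a.val *ᵥ x) = x
    rw [Matrix.mulVec_mulVec, ← Units.val_mul, inv_mul_cancel, Units.val_one, Matrix.one_mulVec]
  right_inv x := by
    change a.val *ᵥ ((a⁻¹).val *ᵥ x) = x
    rw [Matrix.mulVec_mulVec, ← Units.val_mul, mul_inv_cancel, Units.val_one, Matrix.one_mulVec]
  map_add' x y := Matrix.mulVec_add _ _ _
  continuous_toFun := by
    fun_prop
  continuous_invFun := by
    fun_prop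

/-- The modulus character `δ_{U_{m+1}}` on `GL_m`: for a Haar measure `μ` on `U_{m+1} ≃ F^m`,
`∫ f (a⁻¹ x) dμ(x) = δ(a) ∫ f dμ`. -/
noncomputable def delta {m : ℕ} (a : GL (Fin m) F) : ℝ≥0 :=
  letI : MeasurableSpace (Fin m → F) := borel _
  haveI : BorelSpace (Fin m → F) := ⟨rfl⟩
  MeasureTheory.addEquivAddHaarChar (mulVecEquiv a)

theorem delta_one {m : ℕ} : delta (1 : GL (Fin m) F) = 1 := by
  let : MeasurableSpace (Fin m → F) := borel _
  have : BorelSpace (Fin m → F) := ⟨rfl⟩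
  have e : mulVecEquiv (1 : GL (Fin m) F) = ContinuousAddEquiv.refl _ := by
    ext x
    simp [mulVecEquiv]
  rw [delta, e]
  exact MeasureTheory.addEquivAddHaarChar_refl

theorem delta_mul {m : ℕ} (a b : GL (Fin m) F) : delta (a * b) = delta a * delta b := by
  let : MeasurableSpace (Fin m → F) := borel _
  have : BorelSpace (Fin m → F) := ⟨rfl⟩
  have e : mulVecEquiv (a * b) = (mulVecEquiv b).trans (mulVecEquiv a) := by
    ext x
    simp [mulVecEquiv, Matrix.mulVec_mulVec]
  rw [delta, e]
  exact (MeasureTheory.addEquivAddHaarChar_trans ..).trans (mul_comm _ _)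

/-- The representation `δ_{U_{m+2}}^{1/2} σ ⊗ θ` of `P_{m+1} U_{m+2}`, which sends
`diag (b, 1) u(x)` to `δ(b)^{1/2} θ(x_{m+1}) σ(b)`. -/
noncomputable def twistRep (θ : AddChar F ℂ) {m : ℕ} {V : Type*} [AddCommGroup V] [Module ℂ V]
    (σ : Representation ℂ (mirabolic F m) V) : Representation ℂ (PU F m) V where
  toFun g := ((NNReal.sqrt (delta (projP g).1) : ℂ) * thetaPU θ g) • σ (projP g)
  map_one' := by
    simp [delta_one, thetaPU_one]
  map_mul' g h := by
    ext v
    simp [delta_mul, thetaPU_mul, smul_smul]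
    congr 1
    ring

theorem twistRep_emb_mul_u (θ : AddChar F ℂ) {m : ℕ} {V : Type*} [AddCommGroup V] [Module ℂ V]
    (σ : Representation ℂ (mirabolic F m) V) (b : GL (Fin (m + 1)) F) (hb : b ∈ mirabolic F m)
    (x : Fin (m + 1) → F) (h) :
    twistRep θ σ ⟨⟨emb b * u x, b, x, rfl⟩, h⟩ =
      ((NNReal.sqrt (delta b) : ℂ) * θ (x (Fin.last m))) • σ ⟨b, hb⟩ := by
  have e : projP (⟨⟨emb b * u x, b, x, rfl⟩, h⟩ : PU F m) = ⟨b, hb⟩ :=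
    Subtype.ext (levi_emb_mul_u b x)
  change ((NNReal.sqrt (delta (projP _).1) : ℂ) * thetaPU θ _) • σ (projP _) = _
  rw [e, thetaPU_emb_mul_u θ b hb x]

/-- `Φ⁺ σ`, the compact induction of `δ_{U_{m+2}}^{1/2} σ ⊗ θ` from `P_{m+1} U_{m+2}` to
`P_{m+2}`. -/
noncomputable def PhiPlus (θ : AddChar F ℂ) {m : ℕ} {V : Type*} [AddCommGroup V] [Module ℂ V]
    (σ : Representation ℂ (mirabolic F m) V) :
    Representation ℂ (mirabolic F (m + 1)) (cIndSpace (PU F m) (twistRep θ σ)) :=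
  cInd (PU F m) (twistRep θ σ)

end Functor

end GLDist

open GLDist

namespace GLDist

open Topology Filter

/-! ### Topological preliminaries -/

section Prelim

/-! The last row `row g` of the Levi component identifies `P_{n-1}U_n \ P_n` with the nonzero row
vectors in `F^{n-1}`. An element of `Φ⁺σ` is thus a compactly supported section over this space,
with fibre `V` over the last basis vector `e`. The proof shows that an equivariant form `l` is
concentrated on a single orbit of rows and is determined there by a form on the fibre over `e`.

The tool is averaging. A positive character is trivial on compact subgroups, so `l` is invariant
under every compact subgroup of `P_n ∩ H_{p,q}`. By smoothness, the average of a vector over such a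
subgroup is a finite sum, and `l` of the sum is the number of terms times `l` of the vector
(`exists_sum_invariant`, `homChar_sum_eq`). This is used twice.

Unipotent part. The index `n` lies in the second block, so `u(x)` is in `H_{p,q}` when `x` vanishes
on the first block. Since `f(g u(x)) = θ(row g · x) f(g)`, averaging along suitable compact lines of
such `u(x)` kills `f` over any row that has a nonzero entry outside the first block. Hence `l f`
depends only on `f` over `firstRows` (`homChar_eq_zero_of_firstRows`).

Levi part. The index `n-1` lies in the first block, so `e` is in `firstRows`, and `H_{p,q-1}` is
transitive on the nonzero vectors there. The section `sec` of `row` is multiplicative near `e`: the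
elements `sec r`, for `r` in `firstRows` and in a ball about `e`, form a compact subgroup of
`H_{p,q}`. Let `ballMap v` be the section supported over the ball with `sec r ↦ v`. Averaging over
the subgroup yields `vol · l f = ∫ l (ballMap (f (sec z))) dz` for `f` supported over the ball
(`setIntegral_homChar`).

The map is `l ↦ l ∘ ballMap`. Comparing the integral formula for a function supported over a small
neighbourhood of `e` with the formula for its translate by `a` gives equivariance, with `χ' = χ ·
rowModulus / δ^{1/2}`. If `l ∘ ballMap = 0`, then `l` kills everything supported over the ball,
hence over its translates by `H_{p,q-1}`. Finitely many of these cover the part of a given support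
lying in `firstRows`, so `l = 0`. -/

theorem isOpen_forall_mem_of_isCompact {X Y : Type*} [TopologicalSpace X] [TopologicalSpace Y]
    {B : Set Y} (hB : IsCompact B) {U : Set (X × Y)} (hU : IsOpen U) :
    IsOpen {x | ∀ y ∈ B, (x, y) ∈ U} := by
  rw [isOpen_iff_mem_nhds]
  intro x hx
  exact hB.eventually_forall_of_forall_eventually fun y hy => hU.mem_nhds (hx y hy)

variable {G : Type*} [Group G] [TopologicalSpace G]

/-- The powers of `χ g` and of its inverse stay in a bounded set, so neither exceeds `1`. This is
where positivity of the character matters: it makes equivariant forms invariant under compact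
subgroups. -/
theorem PositiveCharacter.eq_one_of_pow_mem (χ : PositiveCharacter G) {S : Set G}
    (hS : IsCompact S) {g : G} (h1 : ∀ n : ℕ, g ^ n ∈ S) (h2 : ∀ n : ℕ, g⁻¹ ^ n ∈ S) :
    χ g = 1 := by
  have hc : Continuous fun g => ((χ g : {x : ℝ // 0 < x}) : ℝ) :=
    continuous_subtype_val.comp χ.continuous
  obtain ⟨M, hM⟩ := (hS.image hc).bddAbove
  have key : ∀ g : G, (∀ n : ℕ, g ^ n ∈ S) → ((χ g : {x : ℝ // 0 < x}) : ℝ) ≤ 1 := by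
    intro g hg
    by_contra! hlt
    obtain ⟨n, hn⟩ := pow_unbounded_of_one_lt M hlt
    have := hM ⟨_, hg n, rfl⟩
    simp only [map_pow, Positive.val_pow] at this
    exact absurd this (not_le.mpr hn)
  refine le_antisymm (key g h1) ?_
  have h3 := key _ h2
  rw [map_inv] at h3
  have h4 : (χ g)⁻¹ ≤ 1 := h3
  exact one_le_of_inv_le_one h4

section CInd

variable {H : Subgroup G} {W : Type*} [AddCommGroup W] [Module ℂ W] {ρ : Representation ℂ H W}

theorem indicator_mem_cIndSpace {f : G → W} (hf : f ∈ cIndSpace H ρ) {B : Set G}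
    (hB : ∀ (h : H) (g : G), (h : G) * g ∈ B ↔ g ∈ B)
    (hB' : ∃ K : OpenSubgroup G, ∀ k ∈ K, ∀ g : G, g * k ∈ B ↔ g ∈ B) :
    B.indicator f ∈ cIndSpace H ρ := by
  classical
  obtain ⟨h1, ⟨K, hK⟩, C, hC, hfC⟩ := hf
  obtain ⟨K', hK'⟩ := hB'
  refine ⟨fun h g => ?_, ⟨K ⊓ K', fun k hk g => ?_⟩, C, hC, fun g hg => hfC g fun h0 => hg ?_⟩
  · by_cases hg : g ∈ B
    · rw [Set.indicator_of_mem hg, Set.indicator_of_mem ((hB h g).mpr hg), h1]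
    · rw [Set.indicator_of_notMem hg, Set.indicator_of_notMem (mt (hB h g).mp hg), map_zero]
  · by_cases hg : g ∈ B
    · rw [Set.indicator_of_mem hg, Set.indicator_of_mem ((hK' k hk.2 g).mpr hg), hK k hk.1]
    · rw [Set.indicator_of_notMem hg, Set.indicator_of_notMem (mt (hK' k hk.2 g).mp hg)]
  · simp [Set.indicator_apply, h0]

end CInd

variable [IsTopologicalGroup G]

/-- The stabilizer of `w` in the compact group `κ` is open, hence of finite index, and the sum over
coset representatives replaces the Haar average. It is not normalized; the factor `s.card` is
cancelled by the users. -/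
theorem exists_sum_invariant {W : Type*} [AddCommGroup W] [Module ℂ W]
    (π : Representation ℂ G W) (κ : Subgroup G) (hκ : IsCompact (κ : Set G)) (w : W)
    (hw : IsOpen {g | π g w = w}) :
    ∃ s : Finset κ, s.Nonempty ∧
      ∀ k ∈ κ, π k (∑ i ∈ s, π i w) = ∑ i ∈ s, π i w := by
  classical
  let K : Subgroup κ :=
    { carrier := {k | π k w = w}
      one_mem' := by simp
      mul_mem' := by
        intro a b ha hb
        simp only [Set.mem_ofPred_eq, Subgroup.coe_mul, map_mul, Module.End.mul_apply] at *
        rw [hb, ha]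
      inv_mem' := by
        intro a ha
        simp only [Set.mem_ofPred_eq] at *
        nth_rw 1 [← ha]
        rw [← Module.End.mul_apply, ← map_mul]
        simp }
  have hK : IsOpen (K : Set κ) := hw.preimage continuous_subtype_val
  have : CompactSpace κ := isCompact_iff_compactSpace.mp hκ
  have : Finite (κ ⧸ K) := K.quotient_finite_of_isOpen hK
  have : Fintype (κ ⧸ K) := Fintype.ofFinite _
  let φ : κ ⧸ K → W := Quotient.lift (fun k : κ => π k w) (by
    intro a b hab
    have h : a⁻¹ * b ∈ K := QuotientGroup.leftRel_apply.mp hab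
    have h' : π (a⁻¹ * b : κ) w = w := h
    have : (b : G) = a * (a⁻¹ * b : κ) := by simp
    change π a w = π b w
    rw [this, map_mul, Module.End.mul_apply, h'])
  have hinj : Function.Injective (Quotient.out : κ ⧸ K → κ) := Quotient.out_injective
  have hsum : ∑ i ∈ Finset.univ.map ⟨Quotient.out, hinj⟩, π (i : κ) w = ∑ c : κ ⧸ K, φ c := by
    rw [Finset.sum_map]
    refine Finset.sum_congr rfl fun c _ => ?_
    conv_rhs => rw [← Quotient.out_eq c]
    rfl
  refine ⟨Finset.univ.map ⟨Quotient.out, hinj⟩, 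
    Finset.map_nonempty.mpr ⟨((1 : κ) : κ ⧸ K), Finset.mem_univ _⟩, fun k hk => ?_⟩
  rw [hsum, map_sum]
  rw [← Equiv.sum_comp (MulAction.toPerm (⟨k, hk⟩ : κ) : Equiv.Perm (κ ⧸ K)) φ]
  refine Finset.sum_congr rfl fun c _ => ?_
  induction c using Quotient.inductionOn with | _ a =>
  change π k (π a w) = π (k * a) w
  rw [map_mul, Module.End.mul_apply]

section CInd

variable {H : Subgroup G} {W : Type*} [AddCommGroup W] [Module ℂ W] {ρ : Representation ℂ H W}

theorem isOpen_stabilizer_cInd (f : cIndSpace H ρ) : IsOpen {g | cInd H ρ g f = f} := by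
  obtain ⟨K, hK⟩ := f.2.2.1
  rw [isOpen_iff_mem_nhds]
  intro g hg
  have h1 : (fun x => g⁻¹ * x) ⁻¹' (K : Set G) ∈ 𝓝 g :=
    ContinuousAt.preimage_mem_nhds (by fun_prop) (by simpa using K.mem_nhds_one)
  filter_upwards [h1] with x hx
  have h2 : cInd H ρ (g⁻¹ * x) f = f := Subtype.ext (funext fun y => hK _ hx y)
  have h3 : x = g * (g⁻¹ * x) := by simp
  rw [h3, map_mul, Module.End.mul_apply, h2, hg]

theorem eventually_eq_of_mem_cIndSpace {f : G → W} (hf : f ∈ cIndSpace H ρ) (g : G) :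
    ∀ᶠ x in 𝓝 g, f x = f g := by
  obtain ⟨K, hK⟩ := hf.2.1
  have h1 : (fun x => g⁻¹ * x) ⁻¹' (K : Set G) ∈ 𝓝 g :=
    ContinuousAt.preimage_mem_nhds (by fun_prop) (by simpa using K.mem_nhds_one)
  filter_upwards [h1] with x hx
  simpa using hK _ hx g

end CInd

/-- `ℂˣ` has no small subgroups: `z ^ 2 - 1 = (z - 1) (z + 1)` and `‖z + 1‖ ≥ 3/2`, so each squaring
multiplies the distance to `1` by at least `3/2`. -/
theorem eq_one_of_forall_norm_pow_sub_one_le {z : ℂ}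
    (h : ∀ n : ℕ, ‖z ^ n - 1‖ ≤ 1 / 2) : z = 1 := by
  have step : ∀ k : ℕ, (3 / 2 : ℝ) ^ k * ‖z - 1‖ ≤ ‖z ^ (2 ^ k) - 1‖ := by
    intro k
    induction k with
    | zero => simp
    | succ k ih =>
      have e : z ^ (2 ^ (k + 1)) - 1 = (z ^ (2 ^ k) - 1) * (z ^ (2 ^ k) + 1) := by ring
      have h2 : (3 / 2 : ℝ) ≤ ‖z ^ (2 ^ k) + 1‖ := by
        have h3 : ‖(2 : ℂ)‖ ≤ ‖z ^ (2 ^ k) + 1‖ + ‖z ^ (2 ^ k) - 1‖ := by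
          refine le_trans (le_of_eq ?_) (norm_sub_le _ _)
          congr 1; ring
        have h4 := h (2 ^ k)
        have h5 : ‖(2 : ℂ)‖ = 2 := by simp
        linarith
      rw [e, norm_mul, pow_succ]
      have := mul_le_mul ih h2 (by norm_num) (norm_nonneg _)
      linarith
  by_contra hz
  have hpos : 0 < ‖z - 1‖ := norm_pos_iff.mpr (sub_ne_zero.mpr hz)
  obtain ⟨k, hk⟩ := pow_unbounded_of_one_lt (1 / 2 / ‖z - 1‖) (by norm_num : (1 : ℝ) < 3 / 2)
  have h1 := (step k).trans (h _)
  rw [div_lt_iff₀ hpos] at hk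
  linarith

end Prelim

/-! ### Characters and compact open sets over a local field -/

section LocalField

variable {F : Type*} [Field F] [ValuativeRel F] [TopologicalSpace F]
  [IsNonarchimedeanLocalField F]

open ValuativeRel

/-- Valuation balls about `0` are stable under multiples, so on a small one all powers of `θ x` stay
near `1`, and the absence of small subgroups in `ℂˣ` applies. -/
theorem isOpen_addChar_eq_one {θ : AddChar F ℂ} (hθ : Continuous θ) : IsOpen {x | θ x = 1} := by
  have h0 : ∀ᶠ x in 𝓝 (0 : F), θ x = 1 := by
    have h1 : ∀ᶠ x in 𝓝 (0 : F), ‖θ x - 1‖ < 1 / 2 := by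
      have : Tendsto (fun x => ‖θ x - 1‖) (𝓝 0) (𝓝 ‖θ 0 - 1‖) :=
        Continuous.tendsto (by fun_prop) 0
      rw [AddChar.map_zero_eq_one, sub_self, norm_zero] at this
      exact this.eventually_lt_const (by norm_num)
    obtain ⟨γ, hγ⟩ := (IsValuativeTopology.mem_nhds_zero_iff _).mp h1
    refine (IsValuativeTopology.mem_nhds_zero_iff _).mpr ⟨γ, fun x hx => ?_⟩
    refine eq_one_of_forall_norm_pow_sub_one_le fun n => ?_
    rw [← AddChar.map_nsmul_eq_pow]
    refine le_of_lt (hγ ?_)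
    change valuation F (n • x) < γ
    induction n with
    | zero => simp
    | succ n ih =>
      rw [succ_nsmul]
      exact (valuation F).map_add_lt ih hx
  rw [isOpen_iff_mem_nhds]
  intro y hy
  have h2 : Tendsto (fun x => x - y) (𝓝 y) (𝓝 0) := by
    have : Tendsto (fun x => x - y) (𝓝 y) (𝓝 (y - y)) := Continuous.tendsto (by fun_prop) y
    rwa [sub_self] at this
  filter_upwards [h2.eventually h0] with x hx
  have h3 : x = x - y + y := by ring
  rw [h3, AddChar.map_add_eq_mul, hx, one_mul, hy]

/-- The inverse is the adjugate divided by the determinant, so its continuity is automatic. -/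
theorem continuous_of_continuous_val {X n : Type*} [TopologicalSpace X] [Fintype n]
    [DecidableEq n] {f : X → GL n F} (hf : Continuous fun x => (f x).val) : Continuous f := by
  refine Units.continuous_iff.mpr ⟨hf, ?_⟩
  have e : (fun x => (f x)⁻¹.val) = fun x => (f x).val.det⁻¹ • (f x).val.adjugate := by
    ext1 x
    rw [Matrix.coe_units_inv, Matrix.inv_def, Ring.inverse_eq_inv']
  rw [e]
  have h : ∀ x, (f x).val.det ≠ 0 := fun x =>
    ((Matrix.isUnit_iff_isUnit_det _).mp (f x).isUnit).ne_zero
  exact (hf.matrix_det.inv₀ h).smul hf.matrix_adjugate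

instance : T2Space F := by
  let := IsTopologicalAddGroup.rightUniformSpace F
  have := isUniformAddGroup_of_addCommGroup (G := F)
  infer_instance

theorem isCompact_integer : IsCompact {x : F | valuation F x ≤ 1} :=
  IsNonarchimedeanLocalField.isCompact_closedBall F 1

theorem isOpen_valuation_lt (γ : (ValueGroupWithZero F)ˣ) :
    IsOpen {x : F | valuation F x < γ} := by
  rw [isOpen_iff_mem_nhds]
  intro x hx
  refine IsValuativeTopology.mem_nhds_iff'.mpr ⟨γ, fun y hy => ?_⟩
  have := (valuation F).map_add_lt hy hx
  simpa using this

theorem isCompact_valuation_lt (γ : (ValueGroupWithZero F)ˣ) :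
    IsCompact {x : F | valuation F x < γ} := by
  have h : IsClosed {x : F | valuation F x < γ} := by
    let A : AddSubgroup F :=
      { carrier := {x : F | valuation F x < γ}
        zero_mem' := by simp
        add_mem' := fun ha hb => (valuation F).map_add_lt ha hb
        neg_mem' := fun ha => by simpa [Valuation.map_neg] using ha }
    exact AddSubgroup.isClosed_of_isOpen A (isOpen_valuation_lt γ)
  exact (IsNonarchimedeanLocalField.isCompact_closedBall F γ).of_isClosed_subset h
    fun x (hx : valuation F x < γ) => hx.le

theorem isOpen_maximal : IsOpen {x : F | valuation F x < 1} := isOpen_valuation_lt 1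

theorem isCompact_maximal : IsCompact {x : F | valuation F x < 1} := isCompact_valuation_lt 1

theorem exists_isCompact_isOpen_subset {ι : Type*} [Finite ι] {r : ι → F} {N : Set (ι → F)}
    (hN : N ∈ 𝓝 r) : ∃ B ⊆ N, IsCompact B ∧ IsOpen B ∧ r ∈ B := by
  rw [nhds_pi, (Filter.hasBasis_pi fun i => IsValuativeTopology.hasBasis_nhds (r i)).mem_iff] at hN
  obtain ⟨⟨I, γ⟩, -, h⟩ := hN
  refine ⟨Set.univ.pi fun i => (fun y => y - r i) ⁻¹' {x | valuation F x < γ i},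
    fun x hx => h fun i _ => hx i trivial, isCompact_univ_pi fun i => ?_,
    isOpen_set_pi Set.finite_univ fun i _ => (isOpen_valuation_lt (γ i)).preimage (by fun_prop),
    fun i _ => by simp⟩
  exact (Homeomorph.subRight (r i)).isCompact_preimage.mpr (isCompact_valuation_lt (γ i))

end LocalField

/-! ### The subgroups `H_{p,q}` in terms of matrix entries -/

section Colour

variable {F : Type*} [Field F]

/-- The indices `w_{p,q} a` with `a < p`. -/
def IsFirst (p q i : ℕ) : Prop := ∃ a < p, wFun p q a = i

theorem isFirst_wFun {p q a : ℕ} : IsFirst p q (wFun p q a) ↔ a < p :=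
  ⟨fun ⟨_, hb, e⟩ => wFun_inj e ▸ hb, fun h => ⟨a, h, rfl⟩⟩

/-- In the 1-based numbering this is the index `n - 1`. It is the reason why the last basis row of
`F^{n-1}` belongs to `firstRows`. -/
theorem isFirst_last {p q m : ℕ} (hq : 1 ≤ q) (hqp : q ≤ p) (hn : p + q = m + 2) :
    IsFirst p q m := by
  refine ⟨p - 1, by omega, ?_⟩
  unfold wFun
  split_ifs <;> omega

/-- In the 1-based numbering this is the index `n`, so that the vectors of `U_n ∩ H_{p,q}` are those
vanishing on the first block. -/
theorem not_isFirst_last {p q m : ℕ} (hq : 1 ≤ q) (hqp : q ≤ p) (hn : p + q = m + 2) :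
    ¬ IsFirst p q (m + 1) := by
  have : wFun p q (m + 1) = m + 1 := by
    unfold wFun
    split_ifs <;> omega
  rw [← this, isFirst_wFun]
  omega

theorem mem_stdLevi_iff {p q n : ℕ} (h : p + q = n) (g : GL (Fin n) F) :
    g ∈ stdLevi F h ↔ ∀ i j : Fin n, ¬ (i.1 < p ↔ j.1 < p) → g.val i j = 0 := by
  set e := (finSumFinEquiv.trans (finCongr h) : Fin p ⊕ Fin q ≃ Fin n) with he
  have hl (a : Fin p) : (e (Sum.inl a)).1 = a.1 := by simp [he]
  have hr (b : Fin q) : (e (Sum.inr b)).1 = p + b.1 := by simp [he]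
  constructor
  · rintro ⟨⟨a, b⟩, rfl⟩ i j hij
    obtain ⟨i, rfl⟩ := e.surjective i
    obtain ⟨j, rfl⟩ := e.surjective j
    change (Matrix.reindex e e (Matrix.fromBlocks a.val 0 0 b.val)) (e i) (e j) = 0
    rcases i with i | i <;> rcases j with j | j <;> simp [hl, hr] at hij ⊢
  · intro hg
    set A := g.val.submatrix e e with hA
    have hA12 : A.toBlocks₁₂ = 0 := by
      ext i j
      refine hg _ _ ?_
      simp [hl, hr]
    have hA21 : A.toBlocks₂₁ = 0 := by
      ext i j
      refine hg _ _ ?_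
      simp [hl, hr]
    have hA' : A = Matrix.fromBlocks A.toBlocks₁₁ 0 0 A.toBlocks₂₂ := by
      conv_lhs => rw [← Matrix.fromBlocks_toBlocks A, hA12, hA21]
    -- Invertibility of the whole block diagonal matrix gives that of both blocks.
    have hdet : A.toBlocks₁₁.det * A.toBlocks₂₂.det ≠ 0 := by
      rw [← Matrix.det_fromBlocks_zero₂₁ A.toBlocks₁₁ 0 A.toBlocks₂₂, ← hA', hA,
        Matrix.det_submatrix_equiv_self]
      exact ((Matrix.isUnit_iff_isUnit_det _).mp g.isUnit).ne_zero
    refine ⟨(Matrix.GeneralLinearGroup.mkOfDetNeZero _ (left_ne_zero_of_mul hdet),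
      Matrix.GeneralLinearGroup.mkOfDetNeZero _ (right_ne_zero_of_mul hdet)), ?_⟩
    apply Units.ext
    change Matrix.reindex e e (Matrix.fromBlocks A.toBlocks₁₁ 0 0 A.toBlocks₂₂) = g.val
    rw [← hA', hA]
    ext i j
    simp

theorem permGL_conj_apply {n : ℕ} (w : Equiv.Perm (Fin n)) (g : GL (Fin n) F) (i j : Fin n) :
    (permGL F w * g * (permGL F w)⁻¹).val (w i) (w j) = g.val i j := by
  have h1 : (permGL F w).val = w⁻¹.permMatrix F := rfl
  have h2 : ((permGL F w)⁻¹).val = w.permMatrix F := by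
    have h3 : (permGL F w)⁻¹ = permGL F w⁻¹ :=
      (map_inv (MonoidHom.toHomUnits (Matrix.permMatrixHom (n := Fin n) (R := F))) w).symm
    rw [h3]
    change (w⁻¹)⁻¹.permMatrix F = _
    rw [inv_inv]
  rw [Units.val_mul, Units.val_mul, h1, h2]
  simp [Equiv.Perm.permMatrix, PEquiv.toMatrix_toPEquiv_mul, PEquiv.mul_toMatrix_toPEquiv]

/-- Conjugation by `w` relabels the indices, turning block diagonality into the condition that
entries between indices of different blocks vanish. The size `q'` is independent of the parameter
`q` of `wFun`, so that one statement serves both `H_{p,q}` and `H_{p,q-1}`. -/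
theorem mem_map_conj_permGL_iff {p q p' q' n : ℕ} (h : p' + q' = n) (w : Equiv.Perm (Fin n))
    (hw : ∀ a, (w a).1 = wFun p q a.1) (hp : p' = p) (g : GL (Fin n) F) :
    g ∈ (stdLevi F h).map (MulAut.conj (permGL F w)).toMonoidHom ↔
      ∀ i j : Fin n, ¬ (IsFirst p q i ↔ IsFirst p q j) → g.val i j = 0 := by
  subst hp
  have hc (g : GL (Fin n) F) : (∀ i j : Fin n, ¬ (IsFirst p' q i ↔ IsFirst p' q j) →
      (permGL F w * g * (permGL F w)⁻¹).val i j = 0) ↔ g ∈ stdLevi F h := by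
    rw [mem_stdLevi_iff]
    constructor
    · intro H i j hij
      rw [← permGL_conj_apply w]
      refine H _ _ ?_
      rwa [hw, hw, isFirst_wFun, isFirst_wFun]
    · intro H i j hij
      obtain ⟨i, rfl⟩ := w.surjective i
      obtain ⟨j, rfl⟩ := w.surjective j
      rw [permGL_conj_apply w]
      refine H _ _ ?_
      rwa [hw, hw, isFirst_wFun, isFirst_wFun] at hij
  constructor
  · rintro ⟨g, hg, rfl⟩
    exact (hc g).mpr hg
  · intro H
    refine ⟨(permGL F w)⁻¹ * g * permGL F w, (hc _).mp ?_, ?_⟩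
    · convert H using 5
      group
    · simp [MulAut.conj_apply, mul_assoc]

theorem mem_Hpq_iff {p q n : ℕ} (hqp : q ≤ p) (hn : p + q = n) (g : GL (Fin n) F) :
    g ∈ Hpq F hqp hn ↔ ∀ i j : Fin n, ¬ (IsFirst p q i ↔ IsFirst p q j) → g.val i j = 0 :=
  mem_map_conj_permGL_iff hn _ (fun _ => rfl) rfl g

theorem mem_Hpq'_iff {p q n : ℕ} (hq : 1 ≤ q) (hqp : q ≤ p) (hn : p + (q - 1) = n)
    (g : GL (Fin n) F) :
    g ∈ Hpq' F hq hqp hn ↔ ∀ i j : Fin n, ¬ (IsFirst p q i ↔ IsFirst p q j) → g.val i j = 0 :=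
  mem_map_conj_permGL_iff hn _ (fun _ => rfl) rfl g

theorem emb_apply_castSucc {n : ℕ} (a : GL (Fin n) F) (i j : Fin n) :
    (emb a).val i.castSucc j.castSucc = a.val i j := by
  have h := congrFun (congrFun (topLeft_emb_mul_u a 0) i) j
  rwa [u_zero, mul_one] at h

theorem emb_apply_last {n : ℕ} (a : GL (Fin n) F) (i : Fin n) :
    (emb a).val i.castSucc (Fin.last n) = 0 := by
  have h := lastCol_emb_mul_u a 0 i
  rwa [u_zero, mul_one, Matrix.mulVec_zero] at h

theorem emb_last_apply {n : ℕ} (a : GL (Fin n) F) (j : Fin (n + 1)) :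
    (emb a).val (Fin.last n) j = if j = Fin.last n then 1 else 0 := by
  have h := lastRow_emb_mul_u a 0 j
  rwa [u_zero, mul_one] at h

theorem u_apply_castSucc {n : ℕ} (x : Fin n → F) (i j : Fin n) :
    (u x).val i.castSucc j.castSucc = (1 : Matrix (Fin n) (Fin n) F) i j := by
  have h := congrFun (congrFun (topLeft_emb_mul_u 1 x) i) j
  rwa [map_one, one_mul] at h

theorem u_apply_last {n : ℕ} (x : Fin n → F) (i : Fin n) :
    (u x).val i.castSucc (Fin.last n) = x i := by
  have h := lastCol_emb_mul_u 1 x i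
  rwa [map_one, one_mul, Units.val_one, Matrix.one_mulVec] at h

theorem u_last_apply {n : ℕ} (x : Fin n → F) (j : Fin (n + 1)) :
    (u x).val (Fin.last n) j = if j = Fin.last n then 1 else 0 := by
  have h := lastRow_emb_mul_u 1 x j
  rwa [map_one, one_mul] at h

/-- The two groups use the same partition on the first `n - 1` indices, because `w_{p,q-1}` is a
restriction of `w_{p,q}`. -/
theorem emb_mem_Hpq {p q m : ℕ} (hq : 1 ≤ q) (hqp : q ≤ p) (hn : p + q = m + 2)
    (hn' : p + (q - 1) = m + 1) {a : GL (Fin (m + 1)) F} (ha : a ∈ Hpq' F hq hqp hn') :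
    emb a ∈ Hpq F hqp hn := by
  rw [mem_Hpq'_iff] at ha
  rw [mem_Hpq_iff]
  intro i j
  induction i using Fin.lastCases with
  | last =>
    intro hij
    rw [emb_last_apply, if_neg]
    rintro rfl
    exact hij Iff.rfl
  | cast i =>
    induction j using Fin.lastCases with
    | last => intro _; exact emb_apply_last a i
    | cast j => rw [emb_apply_castSucc]; exact ha i j

theorem u_mem_Hpq {p q m : ℕ} (hq : 1 ≤ q) (hqp : q ≤ p) (hn : p + q = m + 2)
    {x : Fin (m + 1) → F} (hx : ∀ i : Fin (m + 1), IsFirst p q i → x i = 0) :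
    u x ∈ Hpq F hqp hn := by
  rw [mem_Hpq_iff]
  intro i j
  induction i using Fin.lastCases with
  | last =>
    intro hij
    rw [u_last_apply, if_neg]
    rintro rfl
    exact hij Iff.rfl
  | cast i =>
    induction j using Fin.lastCases with
    | last =>
      intro hij
      rw [u_apply_last]
      have := not_isFirst_last hq hqp hn
      simp only [Fin.val_castSucc, Fin.val_last, this, iff_false, not_not] at hij
      exact hx i hij
    | cast j =>
      intro hij
      rw [u_apply_castSucc, Matrix.one_apply_ne]
      rintro rfl
      exact hij Iff.rfl

end Colour

/-! ### The last row of an element of `GL_{m+1}` -/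

section Row

variable {F : Type*} [Field F]

theorem mem_mirabolic_iff {m : ℕ} (a : GL (Fin (m + 1)) F) :
    a ∈ mirabolic F m ↔ a.val (Fin.last m) = Pi.single (Fin.last m) 1 := by
  constructor
  · rintro ⟨a, x, rfl⟩
    ext j
    rw [lastRow_emb_mul_u, Pi.single_apply]
  · intro h
    set c : Matrix (Fin m) (Fin 1) F := Matrix.of fun i _ => a.val i.castSucc (Fin.last m) with hc
    have hi (i : Fin m) : finSumFinEquiv.symm (Fin.castSucc i) = (Sum.inl i : Fin m ⊕ Fin 1) := by
      rw [Equiv.symm_apply_eq]; rfl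
    have hi' : finSumFinEquiv.symm (Fin.last m) = (Sum.inr 0 : Fin m ⊕ Fin 1) := by
      rw [Equiv.symm_apply_eq]; rfl
    have hA : a.val = Matrix.reindex finSumFinEquiv finSumFinEquiv
        (Matrix.fromBlocks (topLeft a.val) c 0 1) := by
      ext i j
      induction i using Fin.lastCases with
      | last =>
        rw [h]
        induction j using Fin.lastCases with
        | last => simp [hi']
        | cast j => simp [hi, hi', Fin.castSucc_ne_last]
      | cast i =>
        induction j using Fin.lastCases with
        | last => simp [hi, hi', hc]
        | cast j => simp [hi, topLeft]
    have hdet : (topLeft a.val).det ≠ 0 := by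
      have h1 := ((Matrix.isUnit_iff_isUnit_det _).mp a.isUnit).ne_zero
      rw [hA, Matrix.det_reindex_self, Matrix.det_fromBlocks_zero₂₁] at h1
      exact left_ne_zero_of_mul h1
    -- The last column of `emb b * u x` is `b x`, so `x` must be `b⁻¹` applied to the last column of
    -- `a`.
    set b := Matrix.GeneralLinearGroup.mkOfDetNeZero _ hdet with hb
    refine ⟨b, (b⁻¹).val *ᵥ fun i => a.val i.castSucc (Fin.last m), Units.ext ?_⟩
    rw [emb_mul_u_val, Matrix.mulVec_mulVec, ← Units.val_mul, mul_inv_cancel, Units.val_one,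
      Matrix.one_mulVec]
    exact hA

/-- The embedding `a ↦ diag (a, 1)` of `GL_m` in `P_{m+1}`. -/
def embP {m : ℕ} : GL (Fin m) F →* mirabolic F m :=
  emb.codRestrict _ fun a => ⟨a, 0, by rw [u_zero, mul_one]⟩

/-- `u(x)` as an element of `P_{m+1}`. -/
def uP {m : ℕ} (x : Fin m → F) : mirabolic F m := ⟨u x, 1, x, by rw [map_one, one_mul]⟩

theorem levi_embP {m : ℕ} (a : GL (Fin m) F) : levi (embP a) = a := by
  apply Units.ext
  ext i j
  exact emb_apply_castSucc a i j

theorem levi_uP {m : ℕ} (x : Fin m → F) : levi (uP x) = 1 := by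
  apply Units.ext
  ext i j
  exact u_apply_castSucc x i j

theorem exists_eq_embP_mul_uP {m : ℕ} (g : mirabolic F m) : ∃ a x, g = embP a * uP x := by
  obtain ⟨_, a, x, rfl⟩ := g
  exact ⟨a, x, rfl⟩

theorem embP_mul_uP {m : ℕ} (a : GL (Fin m) F) (x : Fin m → F) :
    embP a * uP x = uP (a.val *ᵥ x) * embP a :=
  Subtype.ext (emb_mul_u a x)

/-- The last row of the Levi component of an element of `P_{m+2}`. -/
def row {m : ℕ} (g : mirabolic F (m + 1)) : Fin (m + 1) → F := (levi g).val (Fin.last m)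

theorem row_mul {m : ℕ} (g k : mirabolic F (m + 1)) : row (g * k) = row g ᵥ* (levi k).val := by
  rw [row, map_mul, Units.val_mul, Matrix.mul_apply_eq_vecMul]
  rfl

theorem row_one {m : ℕ} : row (1 : mirabolic F (m + 1)) = Pi.single (Fin.last m) 1 := by
  ext j
  simp [row, Matrix.one_apply, Pi.single_apply, eq_comm]

theorem mem_PU_iff_row {m : ℕ} (g : mirabolic F (m + 1)) :
    g ∈ PU F m ↔ row g = Pi.single (Fin.last m) 1 := by
  rw [PU, Subgroup.mem_comap, mem_mirabolic_iff, row]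

theorem row_PU_mul {m : ℕ} (b : PU F m) (g : mirabolic F (m + 1)) :
    row ((b : mirabolic F (m + 1)) * g) = row g := by
  rw [row_mul, (mem_PU_iff_row _).mp b.2, Matrix.single_one_vecMul]
  rfl

/-- Together with `row_PU_mul`, this says that the fibres of `row` are exactly the cosets of `PU F
m`. -/
theorem mul_inv_mem_PU {m : ℕ} {g k : mirabolic F (m + 1)} (h : row g = row k) :
    g * k⁻¹ ∈ PU F m := by
  rw [mem_PU_iff_row, row_mul, h, ← row_mul, mul_inv_cancel, row_one]

theorem row_ne_zero {m : ℕ} (g : mirabolic F (m + 1)) : row g ≠ 0 := by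
  intro h
  have h1 : row (g * g⁻¹) = 0 := by rw [row_mul, h, Matrix.zero_vecMul]
  rw [mul_inv_cancel, row_one] at h1
  simpa using congrFun h1 (Fin.last m)

/-- The identity matrix with its last row replaced by `r`. -/
noncomputable def secGL {m : ℕ} (r : Fin (m + 1) → F) (hr : r (Fin.last m) ≠ 0) :
    GL (Fin (m + 1)) F :=
  Matrix.GeneralLinearGroup.mkOfDetNeZero ((1 : Matrix _ _ F).updateRow (Fin.last m) r) (by
    rw [← Matrix.cramer_transpose_apply, Matrix.transpose_one, Matrix.cramer_one]
    exact hr)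

theorem secGL_last {m : ℕ} (r : Fin (m + 1) → F) (hr : r (Fin.last m) ≠ 0) :
    (secGL r hr).val (Fin.last m) = r :=
  Matrix.updateRow_self

theorem secGL_of_ne {m : ℕ} (r : Fin (m + 1) → F) (hr : r (Fin.last m) ≠ 0) {i : Fin (m + 1)}
    (hi : i ≠ Fin.last m) : (secGL r hr).val i = Pi.single i 1 := by
  refine (Matrix.updateRow_ne hi).trans ?_
  ext j
  simp [Matrix.one_apply, Pi.single_apply, eq_comm]

theorem vecMul_secGL {m : ℕ} (s r : Fin (m + 1) → F) (hr : r (Fin.last m) ≠ 0)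
    (j : Fin (m + 1)) : (s ᵥ* (secGL r hr).val) j =
      (if j = Fin.last m then 0 else s j) + s (Fin.last m) * r j := by
  rw [Matrix.vecMul, dotProduct, Fin.sum_univ_castSucc, secGL_last]
  congr 1
  have h (i : Fin m) : (secGL r hr).val i.castSucc j = if j = i.castSucc then 1 else 0 := by
    rw [secGL_of_ne r hr (Fin.castSucc_ne_last i), Pi.single_apply]
  simp only [h, mul_ite, mul_one, mul_zero]
  induction j using Fin.lastCases with
  | last => simp [(Fin.castSucc_ne_last _).symm]
  | cast j => simp [Fin.castSucc_ne_last]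

/-- Matrices which differ from the identity only in the last row are closed under products. Hence
the section `sec` is multiplicative, which is what makes `ballSubgroup` a group. -/
theorem secGL_mul_secGL {m : ℕ} (s r : Fin (m + 1) → F) (hs : s (Fin.last m) ≠ 0)
    (hr : r (Fin.last m) ≠ 0) (h : (s ᵥ* (secGL r hr).val) (Fin.last m) ≠ 0) :
    secGL s hs * secGL r hr = secGL (s ᵥ* (secGL r hr).val) h := by
  apply Units.ext
  refine funext fun i => ?_
  rw [Units.val_mul, Matrix.mul_apply_eq_vecMul]
  by_cases hi : i = Fin.last m
  · subst hi
    rw [secGL_last, secGL_last]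
  · rw [secGL_of_ne _ _ hi, secGL_of_ne _ _ hi, Matrix.single_one_vecMul]
    exact secGL_of_ne _ _ hi

open Classical in
/-- A section of `row` over the vectors whose last entry is nonzero. -/
noncomputable def sec {m : ℕ} (r : Fin (m + 1) → F) : mirabolic F (m + 1) :=
  if hr : r (Fin.last m) ≠ 0 then embP (secGL r hr) else 1

theorem sec_of_ne {m : ℕ} {r : Fin (m + 1) → F} (hr : r (Fin.last m) ≠ 0) :
    sec r = embP (secGL r hr) := dif_pos hr

theorem row_embP {m : ℕ} (a : GL (Fin (m + 1)) F) : row (embP a) = a.val (Fin.last m) := by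
  rw [row, levi_embP]

theorem embP_mem_PU {m : ℕ} {a : GL (Fin (m + 1)) F} (ha : a ∈ mirabolic F m) : embP a ∈ PU F m := by
  rw [mem_PU_iff_row, row_embP]
  exact (mem_mirabolic_iff a).mp ha

theorem row_sec {m : ℕ} {r : Fin (m + 1) → F} (hr : r (Fin.last m) ≠ 0) : row (sec r) = r := by
  rw [sec_of_ne hr, row_embP, secGL_last]

theorem sec_single {m : ℕ} : sec (Pi.single (Fin.last m) (1 : F)) = 1 := by
  have h : (Pi.single (Fin.last m) (1 : F) : Fin (m + 1) → F) (Fin.last m) ≠ 0 := by simp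
  rw [sec_of_ne h, ← map_one embP]
  congr 1
  apply Units.ext
  refine funext fun i => ?_
  have h1 (i : Fin (m + 1)) : (1 : GL (Fin (m + 1)) F).val i = Pi.single i 1 := by
    ext j
    simp [Matrix.one_apply, Pi.single_apply, eq_comm]
  by_cases hi : i = Fin.last m
  · subst hi
    rw [secGL_last, h1]
  · rw [secGL_of_ne _ _ hi, h1]

theorem sec_mul_sec {m : ℕ} {s r : Fin (m + 1) → F} (hs : s (Fin.last m) ≠ 0)
    (hr : r (Fin.last m) ≠ 0) : sec s * sec r = sec (s ᵥ* (secGL r hr).val) := by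
  have h : (s ᵥ* (secGL r hr).val) (Fin.last m) ≠ 0 := by
    rw [vecMul_secGL, if_pos rfl, zero_add]
    exact mul_ne_zero hs hr
  rw [sec_of_ne hs, sec_of_ne hr, sec_of_ne h, ← map_mul, secGL_mul_secGL s r hs hr h]

end Row

/-! ### A ball of rows around the last basis vector -/

section RowBall

variable {F : Type*} [Field F] [ValuativeRel F]

open ValuativeRel

/-- The vectors which are congruent to the last basis vector modulo the maximal ideal. -/
def rowBall (F : Type*) [Field F] [ValuativeRel F] (m : ℕ) : Set (Fin (m + 1) → F) :=
  {r | ∀ i, valuation F (r i - (Pi.single (Fin.last m) 1 : Fin (m + 1) → F) i) < 1}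

theorem single_mem_rowBall {m : ℕ} : Pi.single (Fin.last m) 1 ∈ rowBall F m := by
  intro i
  simp

theorem valuation_last_of_mem_rowBall {m : ℕ} {r : Fin (m + 1) → F} (hr : r ∈ rowBall F m) :
    valuation F (r (Fin.last m)) = 1 := by
  have h := hr (Fin.last m)
  rw [Pi.single_eq_same] at h
  have h2 := (valuation F).map_one_add_of_lt h
  rwa [add_sub_cancel] at h2

theorem ne_zero_of_mem_rowBall {m : ℕ} {r : Fin (m + 1) → F} (hr : r ∈ rowBall F m) :
    r (Fin.last m) ≠ 0 := by
  intro h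
  have := valuation_last_of_mem_rowBall hr
  rw [h, map_zero] at this
  exact zero_ne_one this

/-- The last entry is multiplied by a unit congruent to `1`, and once `s (Fin.last m)` is a unit the
other entries move by elements of the maximal ideal. The equivalence is needed for inverses in
`ballSubgroup` and for equality of preimages in the modulus computation. -/
theorem vecMul_secGL_mem_rowBall_iff {m : ℕ} {r s : Fin (m + 1) → F} (hr : r ∈ rowBall F m) :
    s ᵥ* (secGL r (ne_zero_of_mem_rowBall hr)).val ∈ rowBall F m ↔ s ∈ rowBall F m := by
  have hv := valuation_last_of_mem_rowBall hr
  have hr1 := hr (Fin.last m)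
  rw [Pi.single_eq_same] at hr1
  have key : valuation F (s (Fin.last m) * r (Fin.last m) - 1) < 1 ↔
      valuation F (s (Fin.last m) - 1) < 1 := by
    have h1 : s (Fin.last m) * r (Fin.last m) - 1 =
      (s (Fin.last m) - 1) * r (Fin.last m) + (r (Fin.last m) - 1) := by ring
    have h2 : valuation F ((s (Fin.last m) - 1) * r (Fin.last m)) =
        valuation F (s (Fin.last m) - 1) := by rw [map_mul, hv, mul_one]
    constructor
    · intro h
      rw [← h2]
      have h3 : (s (Fin.last m) - 1) * r (Fin.last m) =
        (s (Fin.last m) * r (Fin.last m) - 1) - (r (Fin.last m) - 1) := by ring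
      rw [h3]
      exact (valuation F).map_sub_lt h hr1
    · intro h
      rw [h1]
      exact (valuation F).map_add_lt (by rwa [h2]) hr1
  have hone : valuation F (s (Fin.last m) - 1) < 1 → valuation F (s (Fin.last m)) = 1 := by
    intro h
    have h2 := (valuation F).map_one_add_of_lt h
    rwa [add_sub_cancel] at h2
  have key2 (h : valuation F (s (Fin.last m) - 1) < 1) {j : Fin (m + 1)} (hj : j ≠ Fin.last m) :
      valuation F (s (Fin.last m) * r j) < 1 := by
    have := hr j
    rw [Pi.single_eq_of_ne hj, sub_zero] at this
    rwa [map_mul, hone h, one_mul]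
  constructor
  · intro h j
    have hl := h (Fin.last m)
    rw [vecMul_secGL, if_pos rfl, zero_add, Pi.single_eq_same, key] at hl
    by_cases hj : j = Fin.last m
    · subst hj
      rwa [Pi.single_eq_same]
    · have h1 := h j
      rw [vecMul_secGL, if_neg hj, Pi.single_eq_of_ne hj, sub_zero] at h1
      rw [Pi.single_eq_of_ne hj, sub_zero]
      have h2 := (valuation F).map_sub_lt h1 (key2 hl hj)
      rwa [add_sub_cancel_right] at h2
  · intro h j
    have hl := h (Fin.last m)
    rw [Pi.single_eq_same] at hl
    rw [vecMul_secGL]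
    by_cases hj : j = Fin.last m
    · subst hj
      rwa [if_pos rfl, zero_add, Pi.single_eq_same, key]
    · rw [if_neg hj, Pi.single_eq_of_ne hj, sub_zero]
      have h1 := h j
      rw [Pi.single_eq_of_ne hj, sub_zero] at h1
      exact (valuation F).map_add_lt h1 (key2 hl hj)

end RowBall

/-! ### Continuity of the row map and of its section -/

section RowTopology

variable {F : Type*} [Field F] [ValuativeRel F] [TopologicalSpace F]
  [IsNonarchimedeanLocalField F]

open ValuativeRel

theorem continuous_levi {m : ℕ} : Continuous (levi : mirabolic F m → GL (Fin m) F) :=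
  continuous_of_continuous_val
    ((Units.continuous_val.comp continuous_subtype_val).matrix_submatrix _ _)

theorem continuous_row {m : ℕ} : Continuous (row : mirabolic F (m + 1) → _) := by
  have h : Continuous fun g : mirabolic F (m + 1) => (levi g).val :=
    Units.continuous_val.comp continuous_levi
  exact continuous_pi fun j => h.matrix_elem _ _

theorem continuous_vecMul_levi {m : ℕ} :
    Continuous fun x : mirabolic F (m + 1) × (Fin (m + 1) → F) => x.2 ᵥ* (levi x.1).val := by
  have h : Continuous fun x : mirabolic F (m + 1) × (Fin (m + 1) → F) => (levi x.1).val :=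
    Units.continuous_val.comp (continuous_levi.comp continuous_fst)
  exact continuous_snd.matrix_vecMul h

theorem continuous_embP {m : ℕ} : Continuous (embP : GL (Fin m) F → mirabolic F m) := by
  refine Continuous.subtype_mk (continuous_of_continuous_val ?_) _
  have h : Continuous fun a : GL (Fin m) F => a.val := Units.continuous_val
  exact (h.matrix_fromBlocks continuous_const continuous_const continuous_const).matrix_reindex _ _

theorem continuous_uP {m : ℕ} : Continuous (uP : (Fin m → F) → mirabolic F m) := by
  refine Continuous.subtype_mk (continuous_of_continuous_val ?_) _
  refine Continuous.matrix_reindex (Continuous.matrix_fromBlocks continuous_const ?_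
    continuous_const continuous_const) _ _
  exact continuous_matrix fun i j => continuous_apply i

theorem continuousOn_sec {m : ℕ} :
    ContinuousOn (sec : (Fin (m + 1) → F) → _) {r | r (Fin.last m) ≠ 0} := by
  rw [continuousOn_iff_continuous_domRestrict]
  have h : Set.domRestrict {r : Fin (m + 1) → F | r (Fin.last m) ≠ 0} sec =
      fun r => embP (secGL r.1 r.2) := by
    ext1 r
    exact sec_of_ne r.2
  rw [h]
  refine continuous_embP.comp (continuous_of_continuous_val ?_)
  exact Continuous.matrix_updateRow _ continuous_const continuous_subtype_val

theorem continuousAt_sec {m : ℕ} {r : Fin (m + 1) → F} (hr : r (Fin.last m) ≠ 0) :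
    ContinuousAt sec r :=
  continuousOn_sec.continuousAt
    (IsOpen.mem_nhds (isOpen_ne_fun (continuous_apply _) continuous_const) hr)

theorem isOpen_rowBall {m : ℕ} : IsOpen (rowBall F m) := by
  have h : rowBall F m = ⋂ i, (fun r : Fin (m + 1) → F =>
      r i - (Pi.single (Fin.last m) 1 : Fin (m + 1) → F) i) ⁻¹' {x | valuation F x < 1} := by
    ext r
    simp [rowBall]
  rw [h]
  exact isOpen_iInter_of_finite fun i => isOpen_maximal.preimage (by fun_prop)

theorem isCompact_rowBall {m : ℕ} : IsCompact (rowBall F m) := by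
  have h1 : IsCompact (Set.univ.pi fun _ : Fin (m + 1) => {x : F | valuation F x < 1}) :=
    isCompact_univ_pi fun _ => isCompact_maximal
  have h2 := h1.image (f := fun r => r + (Pi.single (Fin.last m) 1 : Fin (m + 1) → F))
    (by fun_prop)
  convert h2 using 1
  ext r
  constructor
  · intro hr
    exact ⟨r - Pi.single (Fin.last m) 1, fun i _ => hr i, by simp⟩
  · rintro ⟨x, hx, rfl⟩ i
    simpa using hx i trivial

end RowTopology

/-! ### Moduli of automorphisms -/

section Modulus

open MeasureTheory

/-- A compact open set has finite positive measure, so preserving it forces the scaling factor to be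
`1`. -/
theorem addEquivAddHaarChar_eq_one_of_preimage_eq {E : Type*} [AddGroup E] [TopologicalSpace E]
    [IsTopologicalAddGroup E] [LocallyCompactSpace E] [MeasurableSpace E] [BorelSpace E]
    {e : E ≃ₜ+ E} {B : Set E} (hB : IsCompact B) (hBo : IsOpen B) (hBn : B.Nonempty)
    (he : e ⁻¹' B = B) : addEquivAddHaarChar e = 1 := by
  have h := addEquivAddHaarChar_smul_preimage (Measure.addHaar (G := E)) (X := B) e
  rw [he] at h
  have h0 : Measure.addHaar B ≠ 0 := (hBo.measure_pos _ hBn).ne'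
  have h1 : Measure.addHaar B ≠ ⊤ := hB.measure_lt_top.ne
  rw [ENNReal.smul_def, smul_eq_mul] at h
  have h2 : (addEquivAddHaarChar e : ENNReal) = 1 :=
    (ENNReal.mul_left_inj h0 h1).mp (h.trans (one_mul _).symm)
  exact_mod_cast h2

/-- By compactness of `B`, automorphisms near the identity, and their inverses, map `B` into itself.
Moduli are therefore trivial near the identity. -/
theorem eventually_addEquivAddHaarChar_eq_one {X E : Type*} [TopologicalSpace X] [AddGroup E]
    [TopologicalSpace E] [IsTopologicalAddGroup E] [LocallyCompactSpace E] [MeasurableSpace E]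
    [BorelSpace E] {B : Set E} (hB : IsCompact B) (hBo : IsOpen B) (hBn : B.Nonempty)
    {A : X → (E ≃ₜ+ E)} (hA : Continuous fun y : X × E => A y.1 y.2)
    (hA' : Continuous fun y : X × E => (A y.1).symm y.2) {x : X} (hx : ∀ v, A x v = v) :
    ∀ᶠ y in 𝓝 x, addEquivAddHaarChar (A y) = 1 := by
  have h1 := (isOpen_forall_mem_of_isCompact hB (hBo.preimage hA)).mem_nhds (x := x)
    (fun v hv => by simpa [hx] using hv)
  have hx' : ∀ v, (A x).symm v = v := fun v => by
    rw [ContinuousAddEquiv.symm_apply_eq, hx]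
  have h2 := (isOpen_forall_mem_of_isCompact hB (hBo.preimage hA')).mem_nhds (x := x)
    (fun v hv => by simpa [hx'] using hv)
  filter_upwards [h1, h2] with y hy hy'
  refine addEquivAddHaarChar_eq_one_of_preimage_eq hB hBo hBn (Set.ext fun v => ⟨fun hv => ?_, hy v⟩)
  have := hy' _ hv
  simpa using this

variable {F : Type*} [Field F] [ValuativeRel F] [TopologicalSpace F]
  [IsNonarchimedeanLocalField F]

open ValuativeRel

theorem isCompact_pi_maximal {ι : Type*} :
    IsCompact {x : ι → F | ∀ i, valuation F (x i) < 1} := by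
  have h1 : IsCompact (Set.univ.pi fun _ : ι => {x : F | valuation F x < 1}) :=
    isCompact_univ_pi fun _ => isCompact_maximal
  convert h1 using 1
  ext
  simp

theorem isOpen_pi_maximal {ι : Type*} [Finite ι] :
    IsOpen {x : ι → F | ∀ i, valuation F (x i) < 1} := by
  have h : {x : ι → F | ∀ i, valuation F (x i) < 1} =
      ⋂ i, (fun x : ι → F => x i) ⁻¹' {x | valuation F x < 1} := by
    ext
    simp
  rw [h]
  exact isOpen_iInter_of_finite fun i => isOpen_maximal.preimage (by fun_prop)

theorem eventually_delta_eq_one {m : ℕ} : ∀ᶠ a in 𝓝 (1 : GL (Fin m) F), delta a = 1 := by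
  let : MeasurableSpace (Fin m → F) := borel _
  have : BorelSpace (Fin m → F) := ⟨rfl⟩
  have hv : Continuous fun a : GL (Fin m) F => a.val := Units.continuous_val
  have hv' : Continuous fun a : GL (Fin m) F => (a⁻¹).val := hv.comp continuous_inv
  have h1 : Continuous fun y : GL (Fin m) F × (Fin m → F) => mulVecEquiv y.1 y.2 :=
    (hv.comp continuous_fst).matrix_mulVec continuous_snd
  have h2 : Continuous fun y : GL (Fin m) F × (Fin m → F) => (mulVecEquiv y.1).symm y.2 :=
    (hv'.comp continuous_fst).matrix_mulVec continuous_snd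
  have h3 : (0 : Fin m → F) ∈ {x : Fin m → F | ∀ i, valuation F (x i) < 1} := fun i => by simp
  exact eventually_addEquivAddHaarChar_eq_one isCompact_pi_maximal isOpen_pi_maximal ⟨0, h3⟩
    h1 h2 (x := 1) fun v => Matrix.one_mulVec v

theorem delta_pos {m : ℕ} (a : GL (Fin m) F) : 0 < delta a := by
  let : MeasurableSpace (Fin m → F) := borel _
  have : BorelSpace (Fin m → F) := ⟨rfl⟩
  exact addEquivAddHaarChar_pos _

end Modulus

/-! ### Functions supported over the ball of rows -/

section BallFun

variable {F : Type*} [Field F] [ValuativeRel F] {m : ℕ} {V : Type*} [AddCommGroup V] [Module ℂ V]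
  {ρ : Representation ℂ (PU F m) V}

open Classical in
/-- The function `b s(r) ↦ ρ b v` for `r` in the ball of rows, where `s` is the section `sec`. -/
noncomputable def ballFun (ρ : Representation ℂ (PU F m) V) (v : V) (g : mirabolic F (m + 1)) :
    V :=
  if h : row g ∈ rowBall F m then
    ρ ⟨g * (sec (row g))⁻¹, mul_inv_mem_PU (row_sec (ne_zero_of_mem_rowBall h)).symm⟩ v
  else 0

theorem ballFun_of_mem (v : V) {g : mirabolic F (m + 1)} (h : row g ∈ rowBall F m) :
    ballFun ρ v g =
      ρ ⟨g * (sec (row g))⁻¹, mul_inv_mem_PU (row_sec (ne_zero_of_mem_rowBall h)).symm⟩ v :=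
  dif_pos h

theorem ballFun_of_notMem (v : V) {g : mirabolic F (m + 1)} (h : row g ∉ rowBall F m) :
    ballFun ρ v g = 0 := dif_neg h

theorem ballFun_mul (v : V) (b : PU F m) (g : mirabolic F (m + 1)) :
    ballFun ρ v (b * g) = ρ b (ballFun ρ v g) := by
  have e := row_PU_mul b g
  by_cases h : row g ∈ rowBall F m
  · rw [ballFun_of_mem v h, ballFun_of_mem v (by rwa [e]), ← Module.End.mul_apply, ← map_mul]
    congr 2
    ext1
    simp [e, mul_assoc]
  · rw [ballFun_of_notMem v h, ballFun_of_notMem v (by rwa [e]), map_zero]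

theorem ballFun_sec (v : V) {r : Fin (m + 1) → F} (hr : r ∈ rowBall F m) :
    ballFun ρ v (sec r) = v := by
  have h1 := row_sec (ne_zero_of_mem_rowBall hr)
  rw [ballFun_of_mem v (by rwa [h1])]
  have h2 : (⟨sec r * (sec (row (sec r)))⁻¹,
      mul_inv_mem_PU (row_sec (ne_zero_of_mem_rowBall (by rwa [h1]))).symm⟩ : PU F m) = 1 := by
    ext1
    simp [h1]
  rw [h2, map_one, Module.End.one_apply]

theorem ballFun_PU (v : V) (b : PU F m) : ballFun ρ v b = ρ b v := by
  have h := ballFun_mul (ρ := ρ) v b 1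
  rw [mul_one] at h
  rw [h, ← sec_single, ballFun_sec v single_mem_rowBall]

end BallFun

/-! ### Smoothness of the inducing representation and of ball functions -/

section Smooth

variable {F : Type*} [Field F] [ValuativeRel F] [TopologicalSpace F]
  [IsNonarchimedeanLocalField F]

theorem isSmoothRep_of_eventually {G : Type*} [Group G] [TopologicalSpace G]
    [IsTopologicalGroup G] {V : Type*} [AddCommGroup V] [Module ℂ V] {ρ : Representation ℂ G V}
    (h : ∀ v, ∀ᶠ g in 𝓝 (1 : G), ρ g v = v) : IsSmoothRep ρ := by
  intro v
  rw [isOpen_iff_mem_nhds]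
  intro g hg
  have h1 : Tendsto (fun x => g⁻¹ * x) (𝓝 g) (𝓝 1) := by
    have : Tendsto (fun x => g⁻¹ * x) (𝓝 g) (𝓝 (g⁻¹ * g)) := Continuous.tendsto (by fun_prop) g
    rwa [inv_mul_cancel] at this
  filter_upwards [h1.eventually (h v)] with x hx
  have h3 : x = g * (g⁻¹ * x) := by simp
  rw [h3, map_mul, Module.End.mul_apply, hx, hg]

theorem isSmoothRep_twistRep {θ : AddChar F ℂ} (hθ : Continuous θ) {m : ℕ} {V : Type*}
    [AddCommGroup V] [Module ℂ V] {σ : Representation ℂ (mirabolic F m) V} (hσ : IsSmoothRep σ) :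
    IsSmoothRep (twistRep θ σ) := by
  refine isSmoothRep_of_eventually fun v => ?_
  have hp : Continuous (projP : PU F m → mirabolic F m) :=
    Continuous.subtype_mk (continuous_levi.comp continuous_subtype_val) _
  have h1 : ∀ᶠ g in 𝓝 (1 : PU F m), delta (projP g).1 = 1 := by
    have h : Tendsto (fun g : PU F m => (projP g).1) (𝓝 1) (𝓝 1) := by
      simpa [Function.comp_def] using (continuous_subtype_val.comp hp).tendsto 1
    exact h.eventually eventually_delta_eq_one
  have h2 : ∀ᶠ g in 𝓝 (1 : PU F m), thetaPU θ g = 1 := by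
    have hc : Continuous fun g : PU F m =>
        g.1.1.val (Fin.last m).castSucc (Fin.last (m + 1)) :=
      Continuous.matrix_elem (Units.continuous_val.comp
        (continuous_subtype_val.comp continuous_subtype_val)) _ _
    exact ((isOpen_addChar_eq_one hθ).preimage hc).mem_nhds (thetaPU_one θ)
  have h3 : ∀ᶠ g in 𝓝 (1 : PU F m), σ (projP g) v = v :=
    ((hσ v).preimage hp).mem_nhds (by simp)
  filter_upwards [h1, h2, h3] with g h1 h2 h3
  change ((NNReal.sqrt (delta (projP g).1) : ℂ) * thetaPU θ g) • σ (projP g) v = v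
  rw [h1, h2, h3]
  simp

variable {m : ℕ} {V : Type*} [AddCommGroup V] [Module ℂ V] {ρ : Representation ℂ (PU F m) V}

/-- The `PU`-component of `sec r * k` tends to `1` as `k` does, uniformly over the compact ball, and
this makes `ballFun` right invariant under an open subgroup. Membership in `PU F m` is quantified
over because it fails for general points of a neighbourhood in the larger group. -/
theorem eventually_forall_sec_mul_eq (hρ : IsSmoothRep ρ) (v : V) :
    ∀ᶠ k in 𝓝 (1 : mirabolic F (m + 1)), ∀ r ∈ rowBall F m,
      ∀ h : sec r * k * (sec (r ᵥ* (levi k).val))⁻¹ ∈ PU F m, ρ ⟨_, h⟩ v = v := by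
  refine isCompact_rowBall.eventually_forall_of_forall_eventually fun r hr => ?_
  have hU : ∀ᶠ g in 𝓝 (1 : mirabolic F (m + 1)), ∀ h : g ∈ PU F m, ρ ⟨g, h⟩ v = v := by
    obtain ⟨O, hO, e⟩ := isOpen_induced_iff.mp (hρ v)
    have h1 : (1 : mirabolic F (m + 1)) ∈ O := by
      have : (1 : PU F m) ∈ {g | ρ g v = v} := by simp
      rw [← e] at this
      exact this
    filter_upwards [hO.mem_nhds h1] with g hg h
    have : (⟨g, h⟩ : PU F m) ∈ Subtype.val ⁻¹' O := hg
    rwa [e] at this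
  have hr0 := ne_zero_of_mem_rowBall hr
  have hc : ContinuousAt (fun x : mirabolic F (m + 1) × (Fin (m + 1) → F) =>
      sec x.2 * x.1 * (sec (x.2 ᵥ* (levi x.1).val))⁻¹) (1, r) := by
    refine ContinuousAt.mul (ContinuousAt.mul ?_ continuousAt_fst) (ContinuousAt.inv ?_)
    · exact ContinuousAt.comp (f := fun x : mirabolic F (m + 1) × (Fin (m + 1) → F) => x.2)
        (continuousAt_sec hr0) continuousAt_snd
    · refine ContinuousAt.comp (f := fun x : mirabolic F (m + 1) × (Fin (m + 1) → F) =>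
        x.2 ᵥ* (levi x.1).val) (continuousAt_sec ?_) continuous_vecMul_levi.continuousAt
      simpa using hr0
  have h1 : sec r * 1 * (sec (r ᵥ* (levi (1 : mirabolic F (m + 1))).val))⁻¹ = 1 := by simp
  rw [ContinuousAt] at hc
  dsimp only at hc
  rw [h1] at hc
  exact hc.eventually hU

/-- The rows of elements near the identity preserve a compact open set of rows. -/
theorem eventually_row_mul_mem_iff {B : Set (Fin (m + 1) → F)} (hB : IsCompact B)
    (hBo : IsOpen B) : ∀ᶠ k in 𝓝 (1 : mirabolic F (m + 1)), ∀ r,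
      r ᵥ* (levi k).val ∈ B ↔ r ∈ B := by
  have h1 := (isOpen_forall_mem_of_isCompact hB (hBo.preimage continuous_vecMul_levi)).mem_nhds
    (x := (1 : mirabolic F (m + 1))) (fun v hv => by simpa using hv)
  have h2 : ∀ᶠ k in 𝓝 (1 : mirabolic F (m + 1)), ∀ r ∈ B, r ᵥ* (levi k⁻¹).val ∈ B := by
    have : Tendsto (fun k : mirabolic F (m + 1) => k⁻¹) (𝓝 1) (𝓝 1) := by
      simpa using (continuous_inv (G := mirabolic F (m + 1))).tendsto 1
    exact this.eventually h1
  filter_upwards [h1, h2] with k hk hk' r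
  refine ⟨fun h => ?_, hk r⟩
  have := hk' _ h
  rwa [Matrix.vecMul_vecMul, ← Units.val_mul, ← map_mul, mul_inv_cancel, map_one, Units.val_one,
    Matrix.vecMul_one] at this

theorem exists_openSubgroup_of_eventually {G X : Type*} [Group G] [TopologicalSpace G]
    [IsTopologicalGroup G] (f : G → X) (h : ∀ᶠ k in 𝓝 (1 : G), ∀ g, f (g * k) = f g) :
    ∃ K : OpenSubgroup G, ∀ k ∈ K, ∀ g, f (g * k) = f g := by
  let K : Subgroup G :=
    { carrier := {k | ∀ g, f (g * k) = f g}
      one_mem' := by simp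
      mul_mem' := by
        intro a b ha hb g
        rw [← mul_assoc, hb, ha]
      inv_mem' := by
        intro a ha g
        have := ha (g * a⁻¹)
        rw [inv_mul_cancel_right] at this
        exact this.symm }
  exact ⟨⟨K, K.isOpen_of_mem_nhds (g := 1) h⟩, fun k hk => hk⟩

theorem ballFun_mem_cIndSpace (hρ : IsSmoothRep ρ) (v : V) : ballFun ρ v ∈ cIndSpace (PU F m) ρ := by
  refine ⟨ballFun_mul v, exists_openSubgroup_of_eventually _ ?_, sec '' rowBall F m,
    isCompact_rowBall.image_of_continuousOn
      (continuousOn_sec.mono fun r hr => ne_zero_of_mem_rowBall hr), fun g hg => ?_⟩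
  · filter_upwards [eventually_row_mul_mem_iff isCompact_rowBall isOpen_rowBall,
      eventually_forall_sec_mul_eq hρ v] with k hk hk' g
    have hrow := row_mul g k
    by_cases h : row g ∈ rowBall F m
    · have h' : row (g * k) ∈ rowBall F m := by rwa [hrow, hk]
      have h'' := h'
      rw [hrow] at h''
      have hmem : sec (row g) * k * (sec (row g ᵥ* (levi k).val))⁻¹ ∈ PU F m :=
        mul_inv_mem_PU (by
          rw [row_mul, row_sec (ne_zero_of_mem_rowBall h), row_sec (ne_zero_of_mem_rowBall h'')])
      rw [ballFun_of_mem v h, ballFun_of_mem v h']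
      -- Replace `v` on the right by its image under the `PU`-component of `sec (row g) * k`, which
      -- fixes `v`; the two group elements then coincide.
      nth_rw 2 [← hk' _ h hmem]
      rw [← Module.End.mul_apply, ← map_mul]
      congr 2
      ext1
      simp [hrow, mul_assoc]
    · rw [ballFun_of_notMem v h, ballFun_of_notMem v (by rwa [hrow, hk])]
  · have h : row g ∈ rowBall F m := by
      by_contra h
      exact hg (ballFun_of_notMem v h)
    exact ⟨⟨_, mul_inv_mem_PU (row_sec (ne_zero_of_mem_rowBall h)).symm⟩, sec (row g),
      ⟨_, h, rfl⟩, by simp⟩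

/-- `v ↦ ballFun ρ v` as a linear map. -/
noncomputable def ballMap (hρ : IsSmoothRep ρ) : V →ₗ[ℂ] cIndSpace (PU F m) ρ where
  toFun v := ⟨ballFun ρ v, ballFun_mem_cIndSpace hρ v⟩
  map_add' v w := by
    ext g
    by_cases h : row g ∈ rowBall F m
    · simp [ballFun_of_mem _ h]
    · simp [ballFun_of_notMem _ h]
  map_smul' c v := by
    ext g
    by_cases h : row g ∈ rowBall F m
    · simp [ballFun_of_mem _ h]
    · simp [ballFun_of_notMem _ h]

theorem indicator_row_mem_cIndSpace {f : mirabolic F (m + 1) → V} (hf : f ∈ cIndSpace (PU F m) ρ)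
    {B : Set (Fin (m + 1) → F)} (hB : IsCompact B) (hBo : IsOpen B) :
    (row ⁻¹' B).indicator f ∈ cIndSpace (PU F m) ρ := by
  refine indicator_mem_cIndSpace hf (fun h g => ?_) ?_
  · rw [Set.mem_preimage, row_PU_mul, Set.mem_preimage]
  · obtain ⟨K, hK⟩ := exists_openSubgroup_of_eventually (fun g => row g ∈ B) (by
      filter_upwards [eventually_row_mul_mem_iff hB hBo] with k hk g
      rw [row_mul, hk])
    exact ⟨K, fun k hk g => iff_of_eq (hK k hk g)⟩

end Smooth

/-! ### Invariance of linear forms under compact subgroups -/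

section CompactInvariance

variable {G : Type*} [Group G] [TopologicalSpace G] {P H : Subgroup G}
  {V : Type*} [AddCommGroup V] [Module ℂ V] {π : Representation ℂ P V}
  {χ : PositiveCharacter (P ⊓ H : Subgroup G)}

theorem homChar_apply_eq_of_isCompact {l : V →ₗ[ℂ] ℂ} (hl : l ∈ homChar π H χ) {κ : Subgroup P}
    (hκ : IsCompact (κ : Set P)) (hκH : ∀ k ∈ κ, (k : G) ∈ H) {k : P} (hk : k ∈ κ) (v : V) :
    l (π k v) = l v := by
  have : CompactSpace κ := isCompact_iff_compactSpace.mp hκ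
  let j : κ → (P ⊓ H : Subgroup G) := fun k => ⟨k.1.1, k.1.2, hκH _ k.2⟩
  have hj : Continuous j :=
    Continuous.subtype_mk (continuous_subtype_val.comp continuous_subtype_val) _
  have h1 : χ (j ⟨k, hk⟩) = 1 :=
    PositiveCharacter.eq_one_of_pow_mem χ (isCompact_range hj)
      (fun n => ⟨⟨k, hk⟩ ^ n, rfl⟩) (fun n => ⟨(⟨k, hk⟩)⁻¹ ^ n, rfl⟩)
  have h2 := hl (j ⟨k, hk⟩) v
  rw [h1] at h2
  simpa using h2

theorem homChar_sum_eq {l : V →ₗ[ℂ] ℂ} (hl : l ∈ homChar π H χ) {κ : Subgroup P}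
    (hκ : IsCompact (κ : Set P)) (hκH : ∀ k ∈ κ, (k : G) ∈ H) (s : Finset κ) (v : V) :
    l (∑ i ∈ s, π i v) = s.card * l v := by
  rw [map_sum, Finset.sum_congr rfl fun i _ =>
    homChar_apply_eq_of_isCompact hl hκ hκH i.2 v, Finset.sum_const, nsmul_eq_mul]

end CompactInvariance

/-! ### Vanishing away from the rows supported in the first block -/

section Vanishing

variable {F : Type*} [Field F]

/-- The row vectors supported at the indices of the first block. -/
def firstRows (F : Type*) [Field F] (p q m : ℕ) : Set (Fin (m + 1) → F) :=
  {r | ∀ i : Fin (m + 1), ¬ IsFirst p q i → r i = 0}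

theorem uP_mem_PU {m : ℕ} (x : Fin (m + 1) → F) : uP x ∈ PU F m := by
  rw [mem_PU_iff_row, row, levi_uP, ← row_one, row, map_one]

variable [ValuativeRel F] [TopologicalSpace F] [IsNonarchimedeanLocalField F]

open ValuativeRel

theorem isClosed_firstRows {p q m : ℕ} : IsClosed (firstRows F p q m) := by
  have h : firstRows F p q m = ⋂ i : Fin (m + 1), ⋂ _ : ¬ IsFirst p q i, {r | r i = 0} := by
    ext r
    simp [firstRows]
  rw [h]
  exact isClosed_iInter fun i => isClosed_iInter fun _ =>
    isClosed_eq (continuous_apply i) continuous_const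

variable {m : ℕ} {V : Type*} [AddCommGroup V] [Module ℂ V]

theorem twistRep_uP (θ : AddChar F ℂ) (σ : Representation ℂ (mirabolic F m) V)
    (x : Fin (m + 1) → F) (h) :
    twistRep θ σ ⟨uP x, h⟩ = θ (x (Fin.last m)) • (1 : V →ₗ[ℂ] V) := by
  have e : (uP x : mirabolic F (m + 1)) = ⟨emb 1 * u x, 1, x, rfl⟩ :=
    Subtype.ext (((congrArg (· * u x) (map_one emb)).trans (one_mul _)).symm)
  have h' := h
  rw [e] at h'
  have e' : (⟨uP x, h⟩ : PU F m) = ⟨⟨emb 1 * u x, 1, x, rfl⟩, h'⟩ := Subtype.ext e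
  rw [e', twistRep_emb_mul_u θ σ 1 (one_mem _) x h', delta_one]
  have h1 : σ ⟨1, one_mem _⟩ = 1 := map_one σ
  rw [h1]
  simp

/-- Moving `u(x)` to the left of `g` turns it into `u(a x)`, where `a` is the Levi component, and
the last coordinate of `a x` is `row g · x`. So `U_n` acts on the fibre over a row by a character.
-/
theorem cInd_mul_uP {θ : AddChar F ℂ} {σ : Representation ℂ (mirabolic F m) V}
    {f : mirabolic F (m + 1) → V} (hf : f ∈ cIndSpace (PU F m) (twistRep θ σ))
    (g : mirabolic F (m + 1)) (x : Fin (m + 1) → F) :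
    f (g * uP x) = θ (row g ⬝ᵥ x) • f g := by
  obtain ⟨a, z, rfl⟩ := exists_eq_embP_mul_uP g
  have hcomm : (uP z * uP x : mirabolic F (m + 1)) = uP x * uP z := by
    apply Subtype.ext
    change u z * u x = u x * u z
    rw [u_mul, u_mul, add_comm z x]
  have h1 : embP a * uP z * uP x = uP (a.val *ᵥ x) * (embP a * uP z) := by
    rw [mul_assoc, hcomm, ← mul_assoc, embP_mul_uP, mul_assoc]
  have h2 : row (embP a * uP z) ⬝ᵥ x = (a.val *ᵥ x) (Fin.last m) := by
    rw [row, map_mul, levi_embP, levi_uP, mul_one]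
    rfl
  rw [h1, h2]
  have := hf.1 ⟨_, uP_mem_PU (a.val *ᵥ x)⟩ (embP a * uP z)
  rw [twistRep_uP] at this
  exact this

/-- The compact subgroup of all `u(a x)` with `a` integral. -/
def integralLine (x : Fin (m + 1) → F) : Subgroup (mirabolic F (m + 1)) where
  carrier := {g | ∃ a : F, valuation F a ≤ 1 ∧ g = uP (a • x)}
  one_mem' := ⟨0, by simp, Subtype.ext (by rw [zero_smul]; exact u_zero.symm)⟩
  mul_mem' := by
    rintro _ _ ⟨a, ha, rfl⟩ ⟨b, hb, rfl⟩
    refine ⟨a + b, (valuation F).map_add_le ha hb, Subtype.ext ?_⟩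
    rw [add_smul]
    exact u_mul _ _
  inv_mem' := by
    rintro _ ⟨a, ha, rfl⟩
    refine ⟨-a, by rwa [Valuation.map_neg], Subtype.ext ?_⟩
    change (u (a • x))⁻¹ = u (-a • x)
    rw [inv_eq_iff_mul_eq_one, u_mul, neg_smul, add_neg_cancel, u_zero]

theorem isCompact_integralLine (x : Fin (m + 1) → F) :
    IsCompact (integralLine x : Set (mirabolic F (m + 1))) := by
  have h : Continuous fun a : F => (uP (a • x) : mirabolic F (m + 1)) :=
    continuous_uP.comp (by fun_prop)
  convert isCompact_integer.image h using 1
  ext g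
  constructor
  · rintro ⟨a, ha, rfl⟩
    exact ⟨a, ha, rfl⟩
  · rintro ⟨a, ha, rfl⟩
    exact ⟨a, ha, rfl⟩

variable {θ : AddChar F ℂ} {p q : ℕ} {hqp : q ≤ p} {hn : p + q = m + 2}
  {σ : Representation ℂ (mirabolic F m) V}
  {χ : PositiveCharacter (mirabolic F (m + 1) ⊓ Hpq F hqp hn : Subgroup (GL (Fin (m + 2)) F))}
  {l : cIndSpace (PU F m) (twistRep θ σ) →ₗ[ℂ] ℂ}

/-- Averaging `f` over the line through the head `x` multiplies `l f` by a nonzero integer and does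
not enlarge the support. The result is fixed by `u(x)`, so it vanishes wherever `θ (row g · x) ≠ 1`,
and the tail of the list suffices for what remains. -/
theorem homChar_eq_zero_of_list (hq : 1 ≤ q) (hl : l ∈ homChar (PhiPlus θ σ) (Hpq F hqp hn) χ)
    (xs : List (Fin (m + 1) → F))
    (hxs : ∀ x ∈ xs, ∀ i : Fin (m + 1), IsFirst p q i → x i = 0)
    (f : cIndSpace (PU F m) (twistRep θ σ))
    (hf : ∀ g, f.1 g ≠ 0 → ∃ x ∈ xs, θ (row g ⬝ᵥ x) ≠ 1) : l f = 0 := by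
  induction xs generalizing f with
  | nil =>
    have : f = 0 := by
      ext g
      by_contra h
      simpa using hf g h
    rw [this, map_zero]
  | cons x xs ih =>
    have hκH : ∀ k ∈ integralLine x, (k : GL (Fin (m + 2)) F) ∈ Hpq F hqp hn := by
      rintro _ ⟨a, -, rfl⟩
      refine u_mem_Hpq hq hqp hn fun i hi => ?_
      rw [Pi.smul_apply, hxs x (by simp) i hi, smul_zero]
    obtain ⟨s, hs, hinv⟩ := exists_sum_invariant (PhiPlus θ σ) (integralLine x)
      (isCompact_integralLine x) f (isOpen_stabilizer_cInd f)
    set f' := ∑ i ∈ s, PhiPlus θ σ i f with hf'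
    have h1 : l f' = s.card * l f := homChar_sum_eq hl (isCompact_integralLine x) hκH s f
    have h2 : l f' = 0 := by
      refine ih (fun x hx => hxs x (by simp [hx])) f' fun g hg => ?_
      have hfg : f.1 g ≠ 0 := by
        intro h0
        apply hg
        have : f'.1 g = ∑ i ∈ s, f.1 (g * i) := by
          rw [hf', AddSubmonoidClass.coe_finsetSum, Finset.sum_apply]
          rfl
        rw [this]
        refine Finset.sum_eq_zero fun i _ => ?_
        obtain ⟨a, -, ha⟩ := i.2
        rw [ha, cInd_mul_uP f.2, h0, smul_zero]
      obtain ⟨y, hy, hθy⟩ := hf g hfg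
      rcases List.mem_cons.mp hy with rfl | hy
      · exfalso
        have h3 := hinv (uP y) ⟨1, by simp, by rw [one_smul]⟩
        have h4 : f'.1 (g * uP y) = f'.1 g := congrFun (congrArg Subtype.val h3) g
        rw [cInd_mul_uP f'.2] at h4
        have h5 : (θ (row g ⬝ᵥ y) - 1) • f'.1 g = 0 := by rw [sub_smul, h4, one_smul, sub_self]
        rcases smul_eq_zero.mp h5 with h6 | h6
        · exact hθy (sub_eq_zero.mp h6)
        · exact hg h6
      · exact ⟨y, hy, hθy⟩
    rw [h2] at h1
    have h3 : (s.card : ℂ) ≠ 0 := by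
      exact_mod_cast hs.card_ne_zero
    exact (mul_eq_zero.mp h1.symm).resolve_left h3

/-- A nonzero entry of the row outside the first block can be detected by `θ` through some `u(x)` in
`H_{p,q}`, and the same `x` works nearby. Compactness of the support modulo `PU F m` leaves finitely
many `x`. -/
theorem homChar_eq_zero_of_firstRows (hθc : Continuous θ) (hθ : θ ≠ 1) (hq : 1 ≤ q)
    (hl : l ∈ homChar (PhiPlus θ σ) (Hpq F hqp hn) χ) (f : cIndSpace (PU F m) (twistRep θ σ))
    (hf : ∀ g, row g ∈ firstRows F p q m → f.1 g = 0) : l f = 0 := by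
  classical
  obtain ⟨t, ht⟩ : ∃ t, θ t ≠ 1 := by
    by_contra! h
    exact hθ (DFunLike.ext _ _ h)
  obtain ⟨C, hC, hfC⟩ := f.2.2.2
  have key : ∃ xs : List (Fin (m + 1) → F),
      (∀ x ∈ xs, ∀ i : Fin (m + 1), IsFirst p q i → x i = 0) ∧
      ∀ g ∈ C, f.1 g ≠ 0 → ∃ x ∈ xs, θ (row g ⬝ᵥ x) ≠ 1 := by
    refine hC.induction_on (p := fun S => ∃ xs : List (Fin (m + 1) → F),
      (∀ x ∈ xs, ∀ i : Fin (m + 1), IsFirst p q i → x i = 0) ∧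
      ∀ g ∈ S, f.1 g ≠ 0 → ∃ x ∈ xs, θ (row g ⬝ᵥ x) ≠ 1) ⟨[], by simp⟩ ?_ ?_ ?_
    · rintro S T hST ⟨xs, h1, h2⟩
      exact ⟨xs, h1, fun g hg => h2 g (hST hg)⟩
    · rintro S T ⟨xs, h1, h2⟩ ⟨ys, h3, h4⟩
      refine ⟨xs ++ ys, fun x hx => ?_, fun g hg hfg => ?_⟩
      · rcases List.mem_append.mp hx with hx | hx
        exacts [h1 x hx, h3 x hx]
      · rcases hg with hg | hg
        · obtain ⟨x, hx, h⟩ := h2 g hg hfg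
          exact ⟨x, List.mem_append_left _ hx, h⟩
        · obtain ⟨x, hx, h⟩ := h4 g hg hfg
          exact ⟨x, List.mem_append_right _ hx, h⟩
    · intro c _
      by_cases hc : f.1 c = 0
      · refine ⟨_, mem_nhdsWithin_of_mem_nhds (eventually_eq_of_mem_cIndSpace f.2 c), [], by simp,
          fun g hg hfg => (hfg ?_).elim⟩
        exact Eq.trans hg hc
      · have hr : row c ∉ firstRows F p q m := fun h => hc (hf c h)
        simp only [firstRows, Set.mem_ofPred_eq, not_forall] at hr
        obtain ⟨i, hi, hri⟩ := hr
        -- Scaled so that `row c · x = t`, where `θ t ≠ 1`.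
        set x : Fin (m + 1) → F := Pi.single i (t / row c i) with hx
        have hcont : Continuous fun g : mirabolic F (m + 1) => θ (row g ⬝ᵥ x) := by
          have := continuous_row (F := F) (m := m)
          exact hθc.comp (this.dotProduct continuous_const)
        have hU : {g : mirabolic F (m + 1) | θ (row g ⬝ᵥ x) ≠ 1} ∈ 𝓝 c := by
          refine (isOpen_ne_fun hcont continuous_const).mem_nhds ?_
          have : row c ⬝ᵥ x = t := by
            rw [hx, dotProduct_single, mul_div_cancel₀ _ hri]
          rw [Set.mem_ofPred_eq, this]
          exact ht
        refine ⟨_, mem_nhdsWithin_of_mem_nhds hU, [x], ?_, fun g hg _ => ⟨x, by simp, hg⟩⟩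
        intro y hy j hj
        rw [List.mem_singleton.mp hy, hx, Pi.single_eq_of_ne]
        rintro rfl
        exact hi hj
  obtain ⟨xs, h1, h2⟩ := key
  refine homChar_eq_zero_of_list hq hl xs h1 f fun g hg => ?_
  obtain ⟨h, c, hc, rfl⟩ := hfC g hg
  rw [row_PU_mul]
  refine h2 c hc fun h0 => hg ?_
  rw [f.2.1, h0, map_zero]

theorem homChar_eq_of_firstRows (hθc : Continuous θ) (hθ : θ ≠ 1) (hq : 1 ≤ q)
    (hl : l ∈ homChar (PhiPlus θ σ) (Hpq F hqp hn) χ) {f f' : cIndSpace (PU F m) (twistRep θ σ)}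
    (hf : ∀ g, row g ∈ firstRows F p q m → f.1 g = f'.1 g) : l f = l f' := by
  rw [← sub_eq_zero, ← map_sub]
  refine homChar_eq_zero_of_firstRows hθc hθ hq hl _ fun g hg => ?_
  exact sub_eq_zero.mpr (hf g hg)

end Vanishing

open MeasureTheory

/-! ### The action of `H_{p,q-1}` on the rows supported in the first block -/

section FirstRows

variable {F : Type*} [Field F] {p q m : ℕ}

/-- The coordinates on `firstRows F p q m`. -/
abbrev FirstCoord (F : Type*) (p q m : ℕ) : Type _ :=
  {i : Fin (m + 1) // IsFirst p q i} → F

open Classical in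
/-- Extension by zero. -/
noncomputable def extendRow (z : FirstCoord F p q m) : Fin (m + 1) → F :=
  fun i => if h : IsFirst p q i then z ⟨i, h⟩ else 0

theorem extendRow_coe (z : FirstCoord F p q m) (i : {i : Fin (m + 1) // IsFirst p q i}) :
    extendRow z i = z i := dif_pos i.2

theorem extendRow_mem (z : FirstCoord F p q m) : extendRow z ∈ firstRows F p q m :=
  fun _ hi => dif_neg hi

theorem extendRow_restrict {r : Fin (m + 1) → F} (hr : r ∈ firstRows F p q m) :
    extendRow (fun i : {i : Fin (m + 1) // IsFirst p q i} => r i) = r := by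
  ext i
  by_cases hi : IsFirst p q i
  · exact dif_pos hi
  · rw [hr i hi]
    exact dif_neg hi

theorem extendRow_add (z w : FirstCoord F p q m) :
    extendRow (z + w) = extendRow z + extendRow w := by
  ext i
  by_cases hi : IsFirst p q i <;> simp [extendRow, hi]

theorem single_last_mem_firstRows (hl : IsFirst p q m) :
    Pi.single (Fin.last m) 1 ∈ firstRows F p q m := by
  intro i hi
  rw [Pi.single_eq_of_ne]
  rintro rfl
  exact hi hl

theorem preimage_extendRow_nonempty (hl : IsFirst p q m) {B : Set (Fin (m + 1) → F)}
    (hB : Pi.single (Fin.last m) 1 ∈ B) :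
    (extendRow ⁻¹' B : Set (FirstCoord F p q m)).Nonempty := by
  refine ⟨fun i => (Pi.single (Fin.last m) 1 : Fin (m + 1) → F) i, ?_⟩
  rw [Set.mem_preimage, extendRow_restrict (single_last_mem_firstRows hl)]
  exact hB

theorem continuous_extendRow [TopologicalSpace F] :
    Continuous (extendRow : FirstCoord F p q m → Fin (m + 1) → F) := by
  refine continuous_pi fun i => ?_
  by_cases hi : IsFirst p q i
  · have : (fun z : FirstCoord F p q m => extendRow z i) = fun z => z ⟨i, hi⟩ := by
      ext z
      exact dif_pos hi
    rw [this]
    exact continuous_apply _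
  · have : (fun z : FirstCoord F p q m => extendRow z i) = fun z => 0 := by
      ext z
      exact dif_neg hi
    rw [this]
    exact continuous_const

variable (hq : 1 ≤ q) (hqp : q ≤ p) (hn' : p + (q - 1) = m + 1)

theorem vecMul_mem_firstRows {a : GL (Fin (m + 1)) F} (ha : a ∈ Hpq' F hq hqp hn')
    {r : Fin (m + 1) → F} (hr : r ∈ firstRows F p q m) : r ᵥ* a.val ∈ firstRows F p q m := by
  rw [mem_Hpq'_iff] at ha
  intro j hj
  rw [Matrix.vecMul, dotProduct]
  refine Finset.sum_eq_zero fun i _ => ?_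
  by_cases hi : IsFirst p q i
  · rw [ha i j (by simp [hi, hj]), mul_zero]
  · rw [hr i hi, zero_mul]

theorem secGL_mem_Hpq' (hl : IsFirst p q m) {r : Fin (m + 1) → F} (h0 : r (Fin.last m) ≠ 0)
    (hr : r ∈ firstRows F p q m) : secGL r h0 ∈ Hpq' F hq hqp hn' := by
  rw [mem_Hpq'_iff]
  intro i j hij
  by_cases hi : i = Fin.last m
  · subst hi
    rw [secGL_last]
    exact hr j fun hj => hij (iff_of_true hl hj)
  · rw [secGL_of_ne _ _ hi, Pi.single_eq_of_ne]
    rintro rfl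
    exact hij Iff.rfl

theorem permGL_swap_mem_Hpq' (hl : IsFirst p q m) {i : Fin (m + 1)} (hi : IsFirst p q i) :
    permGL F (Equiv.swap i (Fin.last m)) ∈ Hpq' F hq hqp hn' := by
  have h1 : (permGL F (Equiv.swap i (Fin.last m))).val =
    (Equiv.swap i (Fin.last m))⁻¹.permMatrix F := rfl
  rw [mem_Hpq'_iff]
  intro a b hab
  rw [h1, Equiv.swap_inv, Equiv.Perm.permMatrix, PEquiv.toMatrix_apply]
  refine if_neg fun h => hab ?_
  have hb : Equiv.swap i (Fin.last m) a = b := by simpa using h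
  subst hb
  by_cases ha : a = i
  · subst ha
    rw [Equiv.swap_apply_left]
    exact iff_of_true hi hl
  by_cases ha' : a = Fin.last m
  · subst ha'
    rw [Equiv.swap_apply_right]
    exact iff_of_true hl hi
  · rw [Equiv.swap_apply_of_ne_of_ne ha ha']

/-- `H_{p,q-1}` acts transitively on the nonzero rows supported in the first block. -/
theorem exists_mem_Hpq'_row_eq (hl : IsFirst p q m) {r : Fin (m + 1) → F}
    (hr : r ∈ firstRows F p q m) (hr0 : r ≠ 0) :
    ∃ a ∈ Hpq' F hq hqp hn', (Pi.single (Fin.last m) 1 : Fin (m + 1) → F) ᵥ* a.val = r := by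
  obtain ⟨i, hi⟩ := Function.ne_iff.mp hr0
  have hif : IsFirst p q i := by
    by_contra h
    exact hi (hr i h)
  -- Swapping a nonzero entry into the last place makes `secGL` applicable. The swap lies in
  -- `H_{p,q-1}` since both indices belong to the first block.
  set w := permGL F (Equiv.swap i (Fin.last m)) with hw
  have hwmem := permGL_swap_mem_Hpq' (F := F) hq hqp hn' hl hif
  have hw2 : w * w = 1 := by
    rw [hw, permGL, ← map_mul, Equiv.swap_mul_self, map_one]
  have h1 : w.val = (Equiv.swap i (Fin.last m))⁻¹.permMatrix F := rfl
  have hlast : (r ᵥ* w.val) (Fin.last m) ≠ 0 := by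
    rw [h1, Matrix.vecMul_permMatrix]
    simpa using hi
  refine ⟨secGL _ hlast * w, mul_mem (secGL_mem_Hpq' hq hqp hn' hl hlast
    (vecMul_mem_firstRows hq hqp hn' hwmem hr)) hwmem, ?_⟩
  rw [Units.val_mul, ← Matrix.vecMul_vecMul, Matrix.single_one_vecMul]
  change (secGL _ hlast).val (Fin.last m) ᵥ* w.val = r
  rw [secGL_last, Matrix.vecMul_vecMul, ← Units.val_mul, hw2, Units.val_one, Matrix.vecMul_one]

variable [ValuativeRel F] [TopologicalSpace F] [IsNonarchimedeanLocalField F]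

open ValuativeRel

/-- The action of `H_{p,q-1}` on the rows supported in the first block. -/
noncomputable def rowEquiv (a : Hpq' F hq hqp hn') : FirstCoord F p q m ≃ₜ+ FirstCoord F p q m where
  toFun z := fun i => (extendRow z ᵥ* a.1.val) i
  invFun z := fun i => (extendRow z ᵥ* (a⁻¹).1.val) i
  left_inv z := by
    ext i
    dsimp only
    rw [extendRow_restrict (vecMul_mem_firstRows hq hqp hn' a.2 (extendRow_mem z)),
      Matrix.vecMul_vecMul, ← Units.val_mul, Subgroup.coe_inv, mul_inv_cancel, Units.val_one,
      Matrix.vecMul_one, extendRow_coe]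
  right_inv z := by
    ext i
    dsimp only
    rw [extendRow_restrict (vecMul_mem_firstRows hq hqp hn' (a⁻¹).2 (extendRow_mem z)),
      Matrix.vecMul_vecMul, ← Units.val_mul, Subgroup.coe_inv, inv_mul_cancel, Units.val_one,
      Matrix.vecMul_one, extendRow_coe]
  map_add' z w := by
    ext i
    simp [extendRow_add, Matrix.add_vecMul]
  continuous_toFun := by
    have := continuous_extendRow (F := F) (p := p) (q := q) (m := m)
    have h : Continuous fun z : FirstCoord F p q m => extendRow z ᵥ* a.1.val :=
      this.matrix_vecMul continuous_const
    exact continuous_pi fun i => continuous_pi_iff.mp h i.1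
  continuous_invFun := by
    have := continuous_extendRow (F := F) (p := p) (q := q) (m := m)
    have h : Continuous fun z : FirstCoord F p q m => extendRow z ᵥ* (a⁻¹).1.val :=
      this.matrix_vecMul continuous_const
    exact continuous_pi fun i => continuous_pi_iff.mp h i.1

theorem extendRow_rowEquiv (a : Hpq' F hq hqp hn') (z : FirstCoord F p q m) :
    extendRow (rowEquiv hq hqp hn' a z) = extendRow z ᵥ* a.1.val :=
  extendRow_restrict (vecMul_mem_firstRows hq hqp hn' a.2 (extendRow_mem z))

/-- The modulus of the action of `H_{p,q-1}` on the rows supported in the first block. -/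
noncomputable def rowModulus (a : Hpq' F hq hqp hn') : ℝ≥0 :=
  letI : MeasurableSpace (FirstCoord F p q m) := borel _
  haveI : BorelSpace (FirstCoord F p q m) := ⟨rfl⟩
  addEquivAddHaarChar (rowEquiv hq hqp hn' a)

theorem rowModulus_pos (a : Hpq' F hq hqp hn') : 0 < rowModulus hq hqp hn' a := by
  let : MeasurableSpace (FirstCoord F p q m) := borel _
  have : BorelSpace (FirstCoord F p q m) := ⟨rfl⟩
  exact addEquivAddHaarChar_pos _

theorem rowModulus_mul (a b : Hpq' F hq hqp hn') :
    rowModulus hq hqp hn' (a * b) = rowModulus hq hqp hn' a * rowModulus hq hqp hn' b := by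
  let : MeasurableSpace (FirstCoord F p q m) := borel _
  have : BorelSpace (FirstCoord F p q m) := ⟨rfl⟩
  have e : rowEquiv hq hqp hn' (a * b) =
      (rowEquiv hq hqp hn' a).trans (rowEquiv hq hqp hn' b) := by
    ext z i
    change (extendRow z ᵥ* (a * b).1.val) i =
      (extendRow (rowEquiv hq hqp hn' a z) ᵥ* b.1.val) i
    rw [extendRow_rowEquiv, Matrix.vecMul_vecMul]
    rfl
  rw [rowModulus, e]
  exact addEquivAddHaarChar_trans ..

theorem rowModulus_one : rowModulus (F := F) hq hqp hn' 1 = 1 := by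
  have h := rowModulus_mul (F := F) hq hqp hn' 1 1
  rw [mul_one] at h
  have h0 := (rowModulus_pos (F := F) hq hqp hn' 1).ne'
  exact (mul_eq_left₀ h0).mp h.symm

theorem eventually_rowModulus_eq_one :
    ∀ᶠ a in 𝓝 (1 : Hpq' F hq hqp hn'), rowModulus hq hqp hn' a = 1 := by
  let : MeasurableSpace (FirstCoord F p q m) := borel _
  have : BorelSpace (FirstCoord F p q m) := ⟨rfl⟩
  have hv : Continuous fun a : Hpq' F hq hqp hn' => a.1.val :=
    Units.continuous_val.comp continuous_subtype_val
  have hv' : Continuous fun a : Hpq' F hq hqp hn' => (a⁻¹).1.val := hv.comp continuous_inv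
  have he := continuous_extendRow (F := F) (p := p) (q := q) (m := m)
  have h1 : Continuous fun y : Hpq' F hq hqp hn' × FirstCoord F p q m =>
      rowEquiv hq hqp hn' y.1 y.2 := by
    have h : Continuous fun y : Hpq' F hq hqp hn' × FirstCoord F p q m =>
        extendRow y.2 ᵥ* y.1.1.val :=
      (he.comp continuous_snd).matrix_vecMul (hv.comp continuous_fst)
    exact continuous_pi fun i => continuous_pi_iff.mp h i.1
  have h2 : Continuous fun y : Hpq' F hq hqp hn' × FirstCoord F p q m =>
      (rowEquiv hq hqp hn' y.1).symm y.2 := by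
    have h : Continuous fun y : Hpq' F hq hqp hn' × FirstCoord F p q m =>
        extendRow y.2 ᵥ* (y.1⁻¹).1.val :=
      (he.comp continuous_snd).matrix_vecMul (hv'.comp continuous_fst)
    exact continuous_pi fun i => continuous_pi_iff.mp h i.1
  have h3 : (0 : FirstCoord F p q m) ∈ {x : FirstCoord F p q m | ∀ i, valuation F (x i) < 1} :=
    fun i => by simp
  refine eventually_addEquivAddHaarChar_eq_one isCompact_pi_maximal isOpen_pi_maximal ⟨0, h3⟩
    h1 h2 (x := 1) fun z => ?_
  ext i
  change (extendRow z ᵥ* (1 : Matrix (Fin (m + 1)) (Fin (m + 1)) F)) i.1 = z i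
  rw [Matrix.vecMul_one, extendRow_coe]

end FirstRows

/-! ### The integral formula -/

section Integral

/-- The elements `sec r` with `r` in the ball of rows and supported in the first block. -/
noncomputable def ballSubgroup (F : Type*) [Field F] [ValuativeRel F] {p q m : ℕ}
    (hl : IsFirst p q m) : Subgroup (mirabolic F (m + 1)) where
  carrier := {g | ∃ r ∈ rowBall F m, r ∈ firstRows F p q m ∧ g = sec r}
  one_mem' := ⟨_, single_mem_rowBall, single_last_mem_firstRows hl, sec_single.symm⟩
  mul_mem' := by
    rintro _ _ ⟨s, hs, hs', rfl⟩ ⟨r, hr, hr', rfl⟩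
    refine ⟨_, (vecMul_secGL_mem_rowBall_iff hr).mpr hs, fun i hi => ?_,
      sec_mul_sec (ne_zero_of_mem_rowBall hs) (ne_zero_of_mem_rowBall hr)⟩
    rw [vecMul_secGL, hr' i hi, hs' i hi, mul_zero, add_zero, ite_self]
  inv_mem' := by
    rintro _ ⟨r, hr, hr', rfl⟩
    have hr0 := ne_zero_of_mem_rowBall hr
    -- The last row of the inverse matrix.
    set s := (Pi.single (Fin.last m) 1 : Fin (m + 1) → F) ᵥ* ((secGL r hr0)⁻¹).val with hs
    have h1 : s ᵥ* (secGL r hr0).val = Pi.single (Fin.last m) 1 := by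
      rw [hs, Matrix.vecMul_vecMul, ← Units.val_mul, inv_mul_cancel, Units.val_one,
        Matrix.vecMul_one]
    have hs1 : s ∈ rowBall F m := by
      rw [← vecMul_secGL_mem_rowBall_iff hr, h1]
      exact single_mem_rowBall
    refine ⟨s, hs1, fun i hi => ?_, ?_⟩
    · have h2 := vecMul_secGL s r hr0 i
      have hil : i ≠ Fin.last m := by
        rintro rfl
        exact hi hl
      rw [h1, if_neg hil, hr' i hi, mul_zero, add_zero, Pi.single_eq_of_ne hil] at h2
      exact h2.symm
    · have h3 := sec_mul_sec (ne_zero_of_mem_rowBall hs1) hr0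
      rw [h1, sec_single] at h3
      exact (eq_inv_of_mul_eq_one_left h3).symm

end Integral

section Integral

variable {F : Type*} [Field F] [ValuativeRel F] [TopologicalSpace F]
  [IsNonarchimedeanLocalField F] {p q m : ℕ}

open ValuativeRel

theorem isCompact_ballSubgroup (hl : IsFirst p q m) :
    IsCompact (ballSubgroup F hl : Set (mirabolic F (m + 1))) := by
  have h : IsCompact (rowBall F m ∩ firstRows F p q m) :=
    isCompact_rowBall.inter_right isClosed_firstRows
  convert h.image_of_continuousOn (f := sec)
    (continuousOn_sec.mono fun r hr => ne_zero_of_mem_rowBall hr.1) using 1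
  ext g
  constructor
  · rintro ⟨r, h1, h2, rfl⟩
    exact ⟨r, ⟨h1, h2⟩, rfl⟩
  · rintro ⟨r, ⟨h1, h2⟩, rfl⟩
    exact ⟨r, h1, h2, rfl⟩

/-- The coordinates of the ball of rows inside `firstRows F p q m`. -/
def coordBall (F : Type*) [Field F] [ValuativeRel F] (p q m : ℕ) : Set (FirstCoord F p q m) :=
  extendRow ⁻¹' rowBall F m

theorem isOpen_coordBall : IsOpen (coordBall F p q m) :=
  isOpen_rowBall.preimage continuous_extendRow

theorem isCompact_preimage_extendRow {B : Set (Fin (m + 1) → F)} (hB : IsCompact B) :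
    IsCompact (extendRow ⁻¹' B : Set (FirstCoord F p q m)) := by
  have h : IsCompact (B ∩ firstRows F p q m) := hB.inter_right isClosed_firstRows
  convert h.image (f := fun r (i : {i : Fin (m + 1) // IsFirst p q i}) => r i)
    (continuous_pi fun i => continuous_apply i.1) using 1
  ext z
  constructor
  · intro hz
    exact ⟨extendRow z, ⟨hz, extendRow_mem z⟩, funext fun i => extendRow_coe z i⟩
  · rintro ⟨r, ⟨h1, h2⟩, rfl⟩
    rw [Set.mem_preimage, extendRow_restrict h2]
    exact h1

theorem isCompact_coordBall : IsCompact (coordBall F p q m) :=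
  isCompact_preimage_extendRow isCompact_rowBall

/-- By multiplicativity of `sec`, right translation by `k = sec r` becomes the linear change of
variable `z ↦ z · secGL r`, which preserves the compact open ball and so has modulus `1`. -/
theorem setIntegral_ballSubgroup {V : Type*} [MeasurableSpace (FirstCoord F p q m)]
    [BorelSpace (FirstCoord F p q m)] (hq : 1 ≤ q) (hqp : q ≤ p) (hn' : p + (q - 1) = m + 1)
    (hl : IsFirst p q m) (φ : V → ℂ) (f : mirabolic F (m + 1) → V) {k : mirabolic F (m + 1)}
    (hk : k ∈ ballSubgroup F hl) :
    ∫ z in coordBall F p q m, φ (f (sec (extendRow z) * k)) ∂Measure.addHaar =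
      ∫ z in coordBall F p q m, φ (f (sec (extendRow z))) ∂Measure.addHaar := by
  obtain ⟨r, hr, hr', rfl⟩ := hk
  have hr0 := ne_zero_of_mem_rowBall hr
  set A := rowEquiv hq hqp hn' ⟨secGL r hr0, secGL_mem_Hpq' hq hqp hn' hl hr0 hr'⟩ with hA
  have hext (z) : extendRow (A z) = extendRow z ᵥ* (secGL r hr0).val :=
    extendRow_rowEquiv hq hqp hn' _ z
  have hpre : A ⁻¹' coordBall F p q m = coordBall F p q m := by
    ext z
    change extendRow (A z) ∈ rowBall F m ↔ extendRow z ∈ rowBall F m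
    rw [hext, vecMul_secGL_mem_rowBall_iff hr]
  have hone : addEquivAddHaarChar A = 1 :=
    addEquivAddHaarChar_eq_one_of_preimage_eq isCompact_coordBall isOpen_coordBall
      (preimage_extendRow_nonempty hl single_mem_rowBall) hpre
  have hmp : MeasurePreserving A (Measure.addHaar (G := FirstCoord F p q m)) Measure.addHaar := by
    refine ⟨A.toHomeomorph.measurable, ?_⟩
    have := addEquivAddHaarChar_smul_map (Measure.addHaar (G := FirstCoord F p q m)) A
    rwa [hone, one_smul] at this
  have h := hmp.setIntegral_preimage_emb A.toHomeomorph.measurableEmbedding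
    (fun z => φ (f (sec (extendRow z)))) (coordBall F p q m)
  rw [hpre] at h
  rw [← h]
  refine setIntegral_congr_fun isOpen_coordBall.measurableSet fun z hz => ?_
  rw [hext, sec_mul_sec (ne_zero_of_mem_rowBall hz) hr0]

variable {V : Type*} [AddCommGroup V] [Module ℂ V] {θ : AddChar F ℂ}
  {hqp : q ≤ p} {hn : p + q = m + 2} {σ : Representation ℂ (mirabolic F m) V}
  {χ : PositiveCharacter (mirabolic F (m + 1) ⊓ Hpq F hqp hn : Subgroup (GL (Fin (m + 2)) F))}
  {l : cIndSpace (PU F m) (twistRep θ σ) →ₗ[ℂ] ℂ}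

theorem continuousOn_comp_sec (φ : V → ℂ) (f : cIndSpace (PU F m) (twistRep θ σ)) :
    ContinuousOn (fun z : FirstCoord F p q m => φ (f.1 (sec (extendRow z))))
      (coordBall F p q m) := by
  intro z hz
  have h1 : ContinuousAt (fun z : FirstCoord F p q m => sec (extendRow z)) z :=
    ContinuousAt.comp (g := sec) (continuousAt_sec (ne_zero_of_mem_rowBall hz))
      continuous_extendRow.continuousAt
  have h2 := h1.eventually (eventually_eq_of_mem_cIndSpace f.2 (sec (extendRow z)))
  refine ContinuousAt.continuousWithinAt (continuousAt_const.congr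
    (f := fun _ => φ (f.1 (sec (extendRow z)))) ?_)
  filter_upwards [h2] with w hw
  rw [hw]

variable [MeasurableSpace (FirstCoord F p q m)] [BorelSpace (FirstCoord F p q m)]

/-- An equivariant linear form is given, on functions supported over the ball of rows, by
integration of a linear form on `V`. -/
theorem setIntegral_homChar (hθc : Continuous θ) (hθ : θ ≠ 1) (hq : 1 ≤ q)
    (hn' : p + (q - 1) = m + 1) (hρ : IsSmoothRep (twistRep θ σ))
    (hl : l ∈ homChar (PhiPlus θ σ) (Hpq F hqp hn) χ) (f : cIndSpace (PU F m) (twistRep θ σ))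
    (hf : ∀ g, f.1 g ≠ 0 → row g ∈ rowBall F m) :
    ∫ z in coordBall F p q m, l (ballMap hρ (f.1 (sec (extendRow z)))) ∂Measure.addHaar =
      (Measure.addHaar (G := FirstCoord F p q m)).real (coordBall F p q m) * l f := by
  have hlast := isFirst_last hq hqp hn
  set κ := ballSubgroup F hlast with hκ
  have hcκ : IsCompact (κ : Set (mirabolic F (m + 1))) := isCompact_ballSubgroup hlast
  have hκH : ∀ k ∈ κ, (k : GL (Fin (m + 2)) F) ∈ Hpq F hqp hn := by
    rintro _ ⟨r, hr, hr', rfl⟩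
    rw [sec_of_ne (ne_zero_of_mem_rowBall hr)]
    exact emb_mem_Hpq hq hqp hn hn' (secGL_mem_Hpq' hq hqp hn' hlast _ hr')
  obtain ⟨s, hs, hinv⟩ := exists_sum_invariant (PhiPlus θ σ) κ hcκ f
    (isOpen_stabilizer_cInd f)
  set f' := ∑ i ∈ s, PhiPlus θ σ i f with hf'
  have h1 : l f' = s.card * l f := homChar_sum_eq hl hcκ hκH s f
  have hf'apply (g) : f'.1 g = ∑ i ∈ s, f.1 (g * i) := by
    rw [hf', AddSubmonoidClass.coe_finsetSum, Finset.sum_apply]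
    rfl
  -- Invariance under the group of all these `sec r` makes the average constant along the section.
  have hf'sec {r : Fin (m + 1) → F} (hr : r ∈ rowBall F m) (hr' : r ∈ firstRows F p q m) :
      f'.1 (sec r) = f'.1 1 := by
    have h := congrFun (congrArg Subtype.val (hinv (sec r) ⟨r, hr, hr', rfl⟩)) 1
    have h2 : f'.1 (1 * sec r) = f'.1 1 := h
    rwa [one_mul] at h2
  have hf'supp {g} (hg : row g ∉ rowBall F m) : f'.1 g = 0 := by
    rw [hf'apply]
    refine Finset.sum_eq_zero fun i _ => ?_
    by_contra h
    obtain ⟨r, hr, -, e⟩ := i.2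
    have h3 := hf _ h
    have hr0 := ne_zero_of_mem_rowBall hr
    rw [e, row_mul, sec_of_ne hr0, levi_embP, vecMul_secGL_mem_rowBall_iff hr] at h3
    exact hg h3
  -- The two functions agree over `firstRows`, and `l` sees nothing else.
  have h2 : l f' = l (ballMap hρ (f'.1 1)) := by
    refine homChar_eq_of_firstRows hθc hθ hq hl fun g hg => ?_
    change f'.1 g = ballFun (twistRep θ σ) (f'.1 1) g
    by_cases hgb : row g ∈ rowBall F m
    · rw [ballFun_of_mem _ hgb, ← hf'sec hgb hg, ← f'.2.1]
      simp
    · rw [ballFun_of_notMem _ hgb, hf'supp hgb]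
  have h3 : ∫ z in coordBall F p q m, l (ballMap hρ (f'.1 (sec (extendRow z))))
      ∂Measure.addHaar =
      (Measure.addHaar (G := FirstCoord F p q m)).real (coordBall F p q m) * l f' := by
    rw [setIntegral_congr_fun (g := fun _ => l (ballMap hρ (f'.1 1)))
      isOpen_coordBall.measurableSet fun z hz => by
        dsimp only
        rw [hf'sec hz (extendRow_mem z)], setIntegral_const, h2, Complex.real_smul]
  -- Both sides of the formula acquire the same factor `s.card` when `f` is replaced by its average
  -- `f'`, for which the integrand is constant.
  have h4 : ∫ z in coordBall F p q m, l (ballMap hρ (f'.1 (sec (extendRow z))))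
      ∂Measure.addHaar = s.card *
      ∫ z in coordBall F p q m, l (ballMap hρ (f.1 (sec (extendRow z)))) ∂Measure.addHaar := by
    simp only [hf'apply, map_sum]
    rw [integral_finsetSum, Finset.sum_congr rfl fun i _ => setIntegral_ballSubgroup hq hqp hn'
      hlast (fun v => l (ballMap hρ v)) f.1 i.2, Finset.sum_const, nsmul_eq_mul]
    intro i _
    exact (continuousOn_comp_sec (fun v => l (ballMap hρ v))
      (PhiPlus θ σ i f)).integrableOn_compact isCompact_coordBall
  have h5 : (s.card : ℂ) ≠ 0 := by exact_mod_cast hs.card_ne_zero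
  refine mul_left_cancel₀ h5 ?_
  rw [← h4, h3, h1]
  ring

end Integral

/-! ### Restriction to the fibre over the last basis vector -/

section Fibre

variable {F : Type*} [Field F] [ValuativeRel F] [TopologicalSpace F]
  [IsNonarchimedeanLocalField F] {p q m : ℕ}

variable {V : Type*} [AddCommGroup V] [Module ℂ V] {θ : AddChar F ℂ}
  {hqp : q ≤ p} {hn : p + q = m + 2} {σ : Representation ℂ (mirabolic F m) V}
  {χ : PositiveCharacter (mirabolic F (m + 1) ⊓ Hpq F hqp hn : Subgroup (GL (Fin (m + 2)) F))}
  {l : cIndSpace (PU F m) (twistRep θ σ) →ₗ[ℂ] ℂ}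

theorem twistRep_embP {a : GL (Fin (m + 1)) F} (ha : a ∈ mirabolic F m) (h) :
    twistRep θ σ ⟨embP a, h⟩ = (NNReal.sqrt (delta a) : ℂ) • σ ⟨a, ha⟩ := by
  have e : (embP a : mirabolic F (m + 1)) = ⟨emb a * u 0, a, 0, rfl⟩ :=
    Subtype.ext ((mul_one _).symm.trans (congrArg (emb a * ·) u_zero.symm))
  have h' := h
  rw [e] at h'
  have e' : (⟨embP a, h⟩ : PU F m) = ⟨⟨emb a * u 0, a, 0, rfl⟩, h'⟩ := Subtype.ext e
  rw [e', twistRep_emb_mul_u θ σ a ha 0 h', Pi.zero_apply, AddChar.map_zero_eq_one, mul_one]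

theorem homChar_embP (hq : 1 ≤ q) (hn' : p + (q - 1) = m + 1)
    (hl : l ∈ homChar (PhiPlus θ σ) (Hpq F hqp hn) χ) {a : GL (Fin (m + 1)) F}
    (ha : a ∈ Hpq' F hq hqp hn') (f : cIndSpace (PU F m) (twistRep θ σ)) :
    l (PhiPlus θ σ (embP a) f) =
      (((χ ⟨embP a, (embP a).2, emb_mem_Hpq hq hqp hn hn' ha⟩ : {x : ℝ // 0 < x}) : ℝ) : ℂ) *
        l f :=
  hl ⟨embP a, (embP a).2, emb_mem_Hpq hq hqp hn hn' ha⟩ f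

/-- Since `a` need not preserve the ball, `ballFun` is first cut down to a small neighbourhood `B`
of the last basis row, which `a` fixes. The integral formula is then applied to this function and to
its translate: the former involves the volume of `B'`, the latter that of `A ⁻¹' B'`, and their
ratio is `rowModulus`. -/
theorem homChar_ballMap_equivariant (hθc : Continuous θ) (hθ : θ ≠ 1) (hq : 1 ≤ q)
    (hn' : p + (q - 1) = m + 1) (hρ : IsSmoothRep (twistRep θ σ))
    (hl : l ∈ homChar (PhiPlus θ σ) (Hpq F hqp hn) χ) {a : GL (Fin (m + 1)) F}
    (ha : a ∈ mirabolic F m) (ha' : a ∈ Hpq' F hq hqp hn') (v : V) :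
    (NNReal.sqrt (delta a) : ℂ) * l (ballMap hρ (σ ⟨a, ha⟩ v)) =
      (((χ ⟨embP a, (embP a).2, emb_mem_Hpq hq hqp hn hn' ha'⟩ : {x : ℝ // 0 < x}) : ℝ) : ℂ) *
        (rowModulus hq hqp hn' ⟨a, ha'⟩ : ℂ) * l (ballMap hρ v) := by
  let : MeasurableSpace (FirstCoord F p q m) := borel _
  have : BorelSpace (FirstCoord F p q m) := ⟨rfl⟩
  set μ := Measure.addHaar (G := FirstCoord F p q m) with hμ
  have hlast := isFirst_last hq hqp hn
  set e : Fin (m + 1) → F := Pi.single (Fin.last m) 1 with he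
  have hea : e ᵥ* (a⁻¹).val = e := by
    rw [he, Matrix.single_one_vecMul]
    exact (mem_mirabolic_iff _).mp (inv_mem ha)
  have hcont : Continuous fun r : Fin (m + 1) → F => r ᵥ* (a⁻¹).val :=
    continuous_id.matrix_vecMul continuous_const
  have hρa : ballFun (twistRep θ σ) v (embP a) =
      (NNReal.sqrt (delta a) : ℂ) • σ ⟨a, ha⟩ v := by
    rw [ballFun_PU v ⟨embP a, embP_mem_PU ha⟩, twistRep_embP ha]
    rfl
  -- a small ball of rows on which everything is constant
  have hN1 : ∀ᶠ r in 𝓝 e, r ∈ rowBall F m := isOpen_rowBall.mem_nhds single_mem_rowBall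
  have hN2 : ∀ᶠ r in 𝓝 e, r ᵥ* (a⁻¹).val ∈ rowBall F m :=
    (isOpen_rowBall.preimage hcont).mem_nhds (by
      rw [Set.mem_preimage, hea]
      exact single_mem_rowBall)
  have hN3 : ∀ᶠ r in 𝓝 e, ballFun (twistRep θ σ) v (sec (r ᵥ* (a⁻¹).val) * embP a) =
      ballFun (twistRep θ σ) v (embP a) := by
    have h1 : ContinuousAt (fun r : Fin (m + 1) → F =>
        (sec (r ᵥ* (a⁻¹).val) * embP a : mirabolic F (m + 1))) e := by
      refine ContinuousAt.mul (ContinuousAt.comp (g := sec) ?_ hcont.continuousAt)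
        continuousAt_const
      rw [hea]
      exact continuousAt_sec (ne_zero_of_mem_rowBall single_mem_rowBall)
    rw [ContinuousAt, hea, sec_single, one_mul] at h1
    exact h1.eventually (eventually_eq_of_mem_cIndSpace (ballFun_mem_cIndSpace hρ v) _)
  obtain ⟨B, hBN, hBc, hBo, heB⟩ := exists_isCompact_isOpen_subset (hN1.and (hN2.and hN3))
  set B' : Set (FirstCoord F p q m) := extendRow ⁻¹' B with hB'
  have hB'o : IsOpen B' := hBo.preimage continuous_extendRow
  have hB'c : IsCompact B' := isCompact_preimage_extendRow hBc
  have hB'sub : B' ⊆ coordBall F p q m := fun z hz => (hBN hz).1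
  set A := rowEquiv hq hqp hn' ⟨a, ha'⟩ with hA
  have hext (z) : extendRow (A z) = extendRow z ᵥ* a.val := extendRow_rowEquiv hq hqp hn' _ z
  have hinv (r : Fin (m + 1) → F) : (r ᵥ* a.val) ᵥ* (a⁻¹).val = r := by
    rw [Matrix.vecMul_vecMul, ← Units.val_mul, mul_inv_cancel, Units.val_one, Matrix.vecMul_one]
  have hAB : A ⁻¹' B' ⊆ coordBall F p q m := by
    intro z hz
    have h1 : extendRow (A z) ∈ B := hz
    have h2 := (hBN h1).2.1
    rwa [hext, hinv] at h2
  have hABo : IsOpen (A ⁻¹' B') := hB'o.preimage A.continuous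
  have hmeas : (rowModulus hq hqp hn' ⟨a, ha'⟩ : ℝ) * μ.real (A ⁻¹' B') = μ.real B' := by
    have h := addEquivAddHaarChar_smul_preimage μ (X := B') A
    have h2 := congrArg ENNReal.toReal h
    rw [ENNReal.toReal_smul] at h2
    exact h2
  have hpos : μ.real B' ≠ 0 := by
    rw [Measure.real, ENNReal.toReal_ne_zero]
    exact ⟨(hB'o.measure_pos _ (preimage_extendRow_nonempty hlast heB)).ne',
      hB'c.measure_lt_top.ne⟩
  -- the test function
  let f : cIndSpace (PU F m) (twistRep θ σ) :=
    ⟨_, indicator_row_mem_cIndSpace (ballFun_mem_cIndSpace hρ v) hBc hBo⟩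
  have hfmem {g} (hg : row g ∈ B) : f.1 g = ballFun (twistRep θ σ) v g :=
    Set.indicator_of_mem (s := row ⁻¹' B) hg _
  have hfnot {g} (hg : row g ∉ B) : f.1 g = 0 := Set.indicator_of_notMem (s := row ⁻¹' B) hg _
  -- For a function equal to `w` along the section over `S` and zero over the rest of the ball, the
  -- integral is a volume times a value.
  have hI (w : V) {S : Set (FirstCoord F p q m)} (hS : IsOpen S) (hSs : S ⊆ coordBall F p q m)
      (h : cIndSpace (PU F m) (twistRep θ σ))
      (h1 : ∀ z ∈ coordBall F p q m, z ∈ S → h.1 (sec (extendRow z)) = w)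
      (h2 : ∀ z ∈ coordBall F p q m, z ∉ S → h.1 (sec (extendRow z)) = 0) :
      ∫ z in coordBall F p q m, l (ballMap hρ (h.1 (sec (extendRow z)))) ∂μ =
        μ.real S * l (ballMap hρ w) := by
    rw [setIntegral_congr_fun (g := S.indicator fun _ => l (ballMap hρ w))
      isOpen_coordBall.measurableSet fun z hz => ?_, setIntegral_indicator hS.measurableSet,
      Set.inter_eq_right.mpr hSs, setIntegral_const, Complex.real_smul]
    by_cases hzS : z ∈ S
    · rw [Set.indicator_of_mem hzS, h1 z hz hzS]
    · rw [Set.indicator_of_notMem hzS, h2 z hz hzS, map_zero, map_zero]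
  have hrow {z : FirstCoord F p q m} (hz : z ∈ coordBall F p q m) :
      row (sec (extendRow z)) = extendRow z := row_sec (ne_zero_of_mem_rowBall hz)
  have hrow' {z : FirstCoord F p q m} (hz : z ∈ coordBall F p q m) :
      row (sec (extendRow z) * embP a) = extendRow (A z) := by
    rw [row_mul, hrow hz, levi_embP, hext]
  have h1 : (μ.real (coordBall F p q m) : ℂ) * l f = μ.real B' * l (ballMap hρ v) := by
    rw [← setIntegral_homChar hθc hθ hq hn' hρ hl f fun g hg => ?_]
    · refine hI v hB'o hB'sub f (fun z hz hzB => ?_) fun z hz hzB => ?_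
      · rw [hfmem (by rwa [hrow hz]), ballFun_sec v hz]
      · rw [hfnot (by rwa [hrow hz])]
    · by_contra h
      exact hg (hfnot fun h' => h (hBN h').1)
  have h2 : (μ.real (coordBall F p q m) : ℂ) * l (PhiPlus θ σ (embP a) f) =
      μ.real (A ⁻¹' B') * l (ballMap hρ ((NNReal.sqrt (delta a) : ℂ) • σ ⟨a, ha⟩ v)) := by
    have happ (g) : (PhiPlus θ σ (embP a) f).1 g = f.1 (g * embP a) := rfl
    rw [← setIntegral_homChar hθc hθ hq hn' hρ hl (PhiPlus θ σ (embP a) f) fun g hg => ?_]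
    · refine hI _ hABo hAB (PhiPlus θ σ (embP a) f) (fun z hz hzB => ?_) fun z hz hzB => ?_
      · have hzB' : extendRow (A z) ∈ B := hzB
        have h3 := (hBN hzB').2.2
        rw [hext, hinv] at h3
        rw [happ, hfmem (by rwa [hrow' hz]), h3, hρa]
      · rw [happ, hfnot (by rwa [hrow' hz])]
    · by_contra h
      refine hg (hfnot fun h' => h ?_)
      have h3 := (hBN h').2.1
      rwa [row_mul, levi_embP, hinv] at h3
  rw [homChar_embP hq hn' hl ha', map_smul, map_smul, smul_eq_mul] at h2
  have hmeas' : ((rowModulus hq hqp hn' ⟨a, ha'⟩ : ℝ) : ℂ) * (μ.real (A ⁻¹' B') : ℂ) =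
      μ.real B' := by exact_mod_cast hmeas
  have hpos' : (μ.real (A ⁻¹' B') : ℂ) ≠ 0 := by
    intro h0
    rw [h0, mul_zero] at hmeas'
    exact hpos (by exact_mod_cast hmeas'.symm)
  refine mul_left_cancel₀ hpos' ?_
  rw [← h2, mul_left_comm, h1, ← hmeas']
  ring

theorem homChar_eq_zero_of_rowBall (hθc : Continuous θ) (hθ : θ ≠ 1) (hq : 1 ≤ q)
    (hn' : p + (q - 1) = m + 1) (hρ : IsSmoothRep (twistRep θ σ))
    (hl : l ∈ homChar (PhiPlus θ σ) (Hpq F hqp hn) χ) (h0 : l ∘ₗ ballMap hρ = 0)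
    (f : cIndSpace (PU F m) (twistRep θ σ)) (hf : ∀ g, f.1 g ≠ 0 → row g ∈ rowBall F m) :
    l f = 0 := by
  let : MeasurableSpace (FirstCoord F p q m) := borel _
  have : BorelSpace (FirstCoord F p q m) := ⟨rfl⟩
  have h := setIntegral_homChar hθc hθ hq hn' hρ hl f hf
  have h1 (v : V) : l (ballMap hρ v) = 0 := LinearMap.congr_fun h0 v
  simp only [h1, integral_zero] at h
  refine (mul_eq_zero.mp h.symm).resolve_left ?_
  refine Complex.ofReal_ne_zero.mpr (ENNReal.toReal_ne_zero.mpr ?_)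
  exact ⟨(isOpen_coordBall.measure_pos _ (preimage_extendRow_nonempty (isFirst_last hq hqp hn)
    single_mem_rowBall)).ne', isCompact_coordBall.measure_lt_top.ne⟩

/-- The part of `f` over the ball translated by the head `a` is moved into the ball itself by `embP
a`, which changes `l` only by a nonzero scalar, and so it is killed. The remainder is covered over
`firstRows` by the tail; with no translate left, it vanishes over `firstRows`. -/
theorem homChar_eq_zero_of_list_rowBall (hθc : Continuous θ) (hθ : θ ≠ 1) (hq : 1 ≤ q)
    (hn' : p + (q - 1) = m + 1) (hρ : IsSmoothRep (twistRep θ σ))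
    (hl : l ∈ homChar (PhiPlus θ σ) (Hpq F hqp hn) χ) (h0 : l ∘ₗ ballMap hρ = 0)
    (as : List (GL (Fin (m + 1)) F)) (has : ∀ a ∈ as, a ∈ Hpq' F hq hqp hn')
    (f : cIndSpace (PU F m) (twistRep θ σ))
    (hf : ∀ g, row g ∈ firstRows F p q m → f.1 g ≠ 0 →
      ∃ a ∈ as, row g ᵥ* (a⁻¹).val ∈ rowBall F m) :
    l f = 0 := by
  induction as generalizing f with
  | nil =>
    refine homChar_eq_zero_of_firstRows hθc hθ hq hl f fun g hg => ?_
    by_contra h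
    simpa using hf g hg h
  | cons a as ih =>
    have ha : a ∈ Hpq' F hq hqp hn' := has a (by simp)
    have hcont : Continuous fun r : Fin (m + 1) → F => r ᵥ* (a⁻¹).val :=
      continuous_id.matrix_vecMul continuous_const
    have hcont' : Continuous fun r : Fin (m + 1) → F => r ᵥ* a.val :=
      continuous_id.matrix_vecMul continuous_const
    have hinv (r : Fin (m + 1) → F) : (r ᵥ* a.val) ᵥ* (a⁻¹).val = r := by
      rw [Matrix.vecMul_vecMul, ← Units.val_mul, mul_inv_cancel, Units.val_one, Matrix.vecMul_one]
    have hinv' (r : Fin (m + 1) → F) : (r ᵥ* (a⁻¹).val) ᵥ* a.val = r := by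
      rw [Matrix.vecMul_vecMul, ← Units.val_mul, inv_mul_cancel, Units.val_one, Matrix.vecMul_one]
    set B : Set (Fin (m + 1) → F) := (fun r => r ᵥ* (a⁻¹).val) ⁻¹' rowBall F m with hB
    have hBo : IsOpen B := isOpen_rowBall.preimage hcont
    have hBc : IsCompact B := by
      convert isCompact_rowBall.image hcont' using 1
      ext r
      constructor
      · intro hr
        exact ⟨_, hr, hinv' r⟩
      · rintro ⟨s, hs, rfl⟩
        rw [hB, Set.mem_preimage, hinv]
        exact hs
    let f1 : cIndSpace (PU F m) (twistRep θ σ) := ⟨_, indicator_row_mem_cIndSpace f.2 hBc hBo⟩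
    have hmem {g} (hg : row g ∈ B) : f1.1 g = f.1 g := Set.indicator_of_mem (s := row ⁻¹' B) hg _
    have hnot {g} (hg : row g ∉ B) : f1.1 g = 0 := Set.indicator_of_notMem (s := row ⁻¹' B) hg _
    have h1 : l f1 = 0 := by
      have h2 : l (PhiPlus θ σ (embP a) f1) = 0 := by
        refine homChar_eq_zero_of_rowBall hθc hθ hq hn' hρ hl h0 _ fun g hg => ?_
        by_contra h
        refine hg (hnot fun h' => h ?_)
        rwa [hB, Set.mem_preimage, row_mul, levi_embP, hinv] at h'
      rw [homChar_embP hq hn' hl ha] at h2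
      refine (mul_eq_zero.mp h2).resolve_left ?_
      exact Complex.ofReal_ne_zero.mpr (χ _).2.ne'
    have h2 : l (f - f1) = 0 := by
      refine ih (fun a ha => has a (by simp [ha])) (f - f1) fun g hg hfg => ?_
      have hsub : (f - f1).1 g = f.1 g - f1.1 g := rfl
      have hgB : row g ∉ B := by
        intro h
        rw [hsub, hmem h, sub_self] at hfg
        exact hfg rfl
      rw [hsub, hnot hgB, sub_zero] at hfg
      obtain ⟨b, hb, hgb⟩ := hf g hg hfg
      rcases List.mem_cons.mp hb with rfl | hb
      · exact absurd hgb hgB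
      · exact ⟨b, hb, hgb⟩
    rw [map_sub, h1, sub_zero] at h2
    exact h2

/-- Transitivity of `H_{p,q-1}` puts each row of `firstRows` in a translate of the ball, and near a
row outside the closed set `firstRows` nothing needs covering. Compactness of the support modulo `PU
F m` gives a finite list of translates. -/
theorem homChar_eq_zero_of_comp_ballMap (hθc : Continuous θ) (hθ : θ ≠ 1) (hq : 1 ≤ q)
    (hn' : p + (q - 1) = m + 1) (hρ : IsSmoothRep (twistRep θ σ))
    (hl : l ∈ homChar (PhiPlus θ σ) (Hpq F hqp hn) χ) (h0 : l ∘ₗ ballMap hρ = 0) : l = 0 := by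
  ext f
  obtain ⟨C, hC, hfC⟩ := f.2.2.2
  have hlast := isFirst_last hq hqp hn
  have key : ∃ as : List (GL (Fin (m + 1)) F), (∀ a ∈ as, a ∈ Hpq' F hq hqp hn') ∧
      ∀ g ∈ C, row g ∈ firstRows F p q m → ∃ a ∈ as, row g ᵥ* (a⁻¹).val ∈ rowBall F m := by
    refine hC.induction_on (p := fun S => ∃ as : List (GL (Fin (m + 1)) F),
      (∀ a ∈ as, a ∈ Hpq' F hq hqp hn') ∧
      ∀ g ∈ S, row g ∈ firstRows F p q m → ∃ a ∈ as, row g ᵥ* (a⁻¹).val ∈ rowBall F m)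
      ⟨[], by simp⟩ ?_ ?_ ?_
    · rintro S T hST ⟨as, h1, h2⟩
      exact ⟨as, h1, fun g hg => h2 g (hST hg)⟩
    · rintro S T ⟨as, h1, h2⟩ ⟨bs, h3, h4⟩
      refine ⟨as ++ bs, fun a ha => ?_, fun g hg hfg => ?_⟩
      · rcases List.mem_append.mp ha with ha | ha
        exacts [h1 a ha, h3 a ha]
      · rcases hg with hg | hg
        · obtain ⟨a, ha, h⟩ := h2 g hg hfg
          exact ⟨a, List.mem_append_left _ ha, h⟩
        · obtain ⟨a, ha, h⟩ := h4 g hg hfg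
          exact ⟨a, List.mem_append_right _ ha, h⟩
    · intro c _
      by_cases hc : row c ∈ firstRows F p q m
      · obtain ⟨a, ha, hac⟩ := exists_mem_Hpq'_row_eq hq hqp hn' hlast hc (row_ne_zero c)
        have hcont : Continuous fun g : mirabolic F (m + 1) => row g ᵥ* (a⁻¹).val := by
          have := continuous_row (F := F) (m := m)
          exact this.matrix_vecMul continuous_const
        refine ⟨_, mem_nhdsWithin_of_mem_nhds ((isOpen_rowBall.preimage hcont).mem_nhds ?_), [a],
          by simpa using ha, fun g hg _ => ⟨a, by simp, hg⟩⟩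
        rw [Set.mem_preimage, ← hac, Matrix.vecMul_vecMul, ← Units.val_mul, mul_inv_cancel,
          Units.val_one, Matrix.vecMul_one]
        exact single_mem_rowBall
      · exact ⟨_, mem_nhdsWithin_of_mem_nhds
          ((isClosed_firstRows.isOpen_compl.preimage continuous_row).mem_nhds hc), [], by simp,
          fun g hg hg' => absurd hg' hg⟩
  obtain ⟨as, h1, h2⟩ := key
  refine homChar_eq_zero_of_list_rowBall hθc hθ hq hn' hρ hl h0 as h1 f fun g hg hfg => ?_
  obtain ⟨h, c, hc, rfl⟩ := hfC g hfg
  rw [row_PU_mul] at hg ⊢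
  exact h2 c hc hg

end Fibre

/-! ### The character -/

section Character

/-- Multiplicativity spreads triviality near `1` to local constancy everywhere; this gives the
continuity of both moduli. -/
theorem continuous_of_eventually_eq_one {G M : Type*} [Group G] [TopologicalSpace G]
    [IsTopologicalGroup G] [Monoid M] [TopologicalSpace M] {f : G → M}
    (hmul : ∀ a b, f (a * b) = f a * f b) (h : ∀ᶠ g in 𝓝 (1 : G), f g = 1) : Continuous f := by
  rw [continuous_iff_continuousAt]
  intro g
  have h1 : Tendsto (fun x => g⁻¹ * x) (𝓝 g) (𝓝 1) := by
    have : Tendsto (fun x => g⁻¹ * x) (𝓝 g) (𝓝 (g⁻¹ * g)) := Continuous.tendsto (by fun_prop) g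
    rwa [inv_mul_cancel] at this
  refine continuousAt_const.congr (f := fun _ => f g) ?_
  filter_upwards [h1.eventually h] with x hx
  rw [← mul_one (f g), ← hx, ← hmul, mul_inv_cancel_left]

variable {F : Type*} [Field F] [ValuativeRel F] [TopologicalSpace F]
  [IsNonarchimedeanLocalField F] {p q m : ℕ}

theorem continuous_delta : Continuous (delta : GL (Fin m) F → ℝ≥0) :=
  continuous_of_eventually_eq_one delta_mul eventually_delta_eq_one

theorem continuous_rowModulus (hq : 1 ≤ q) (hqp : q ≤ p) (hn' : p + (q - 1) = m + 1) :
    Continuous (rowModulus (F := F) hq hqp hn') :=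
  continuous_of_eventually_eq_one (rowModulus_mul hq hqp hn')
    (eventually_rowModulus_eq_one hq hqp hn')

/-- The character of `P_{m+1} ∩ H_{p,q-1}` obtained from `χ` by restriction and by the moduli
of the actions on `U_{m+2}` and on the rows supported in the first block. -/
noncomputable def restrictedChar (hq : 1 ≤ q) (hqp : q ≤ p) (hn : p + q = m + 2)
    (hn' : p + (q - 1) = m + 1)
    (χ : PositiveCharacter
      (mirabolic F (m + 1) ⊓ Hpq F hqp hn : Subgroup (GL (Fin (m + 2)) F))) :
    PositiveCharacter (mirabolic F m ⊓ Hpq' F hq hqp hn' : Subgroup (GL (Fin (m + 1)) F)) where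
  toFun a := χ ⟨embP a.1, (embP a.1).2, emb_mem_Hpq hq hqp hn hn' a.2.2⟩ *
    ⟨(rowModulus hq hqp hn' ⟨a.1, a.2.2⟩ / NNReal.sqrt (delta a.1) : ℝ≥0),
      NNReal.coe_pos.mpr (div_pos (rowModulus_pos hq hqp hn' _)
        (NNReal.sqrt_pos.mpr (delta_pos _)))⟩
  map_one' := by
    have h1 : (⟨embP (1 : GL (Fin (m + 1)) F), (embP 1).2,
        emb_mem_Hpq hq hqp hn hn' (one_mem _)⟩ :
        (mirabolic F (m + 1) ⊓ Hpq F hqp hn : Subgroup (GL (Fin (m + 2)) F))) = 1 :=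
      Subtype.ext (map_one emb)
    refine Subtype.ext ?_
    change ((χ ⟨embP (1 : GL (Fin (m + 1)) F), _⟩ : {x : ℝ // 0 < x}) : ℝ) *
      ((rowModulus hq hqp hn' 1 / NNReal.sqrt (delta (1 : GL (Fin (m + 1)) F)) : ℝ≥0) : ℝ) = 1
    rw [h1, map_one, rowModulus_one, delta_one]
    simp
  map_mul' a b := by
    have h1 : (⟨embP (a.1 * b.1), (embP (a.1 * b.1)).2,
        emb_mem_Hpq hq hqp hn hn' (mul_mem a.2.2 b.2.2)⟩ :
        (mirabolic F (m + 1) ⊓ Hpq F hqp hn : Subgroup (GL (Fin (m + 2)) F))) =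
        ⟨embP a.1, (embP a.1).2, emb_mem_Hpq hq hqp hn hn' a.2.2⟩ *
        ⟨embP b.1, (embP b.1).2, emb_mem_Hpq hq hqp hn hn' b.2.2⟩ :=
      Subtype.ext (map_mul emb a.1 b.1)
    have h2 := rowModulus_mul (F := F) hq hqp hn' ⟨a.1, a.2.2⟩ ⟨b.1, b.2.2⟩
    refine Subtype.ext ?_
    change ((χ ⟨embP (a.1 * b.1), _⟩ : {x : ℝ // 0 < x}) : ℝ) *
      ((rowModulus hq hqp hn' (⟨a.1, a.2.2⟩ * ⟨b.1, b.2.2⟩) /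
        NNReal.sqrt (delta (a.1 * b.1)) : ℝ≥0) : ℝ) = (χ _ : ℝ) * _ * ((χ _ : ℝ) * _)
    rw [h1, map_mul, h2, delta_mul, NNReal.sqrt_mul, mul_div_mul_comm]
    push_cast
    change _ * _ * _ = _
    ring
  continuous_toFun := by
    have hj : Continuous fun a : (mirabolic F m ⊓ Hpq' F hq hqp hn' :
        Subgroup (GL (Fin (m + 1)) F)) =>
        (⟨embP a.1, (embP a.1).2, emb_mem_Hpq hq hqp hn hn' a.2.2⟩ :
        (mirabolic F (m + 1) ⊓ Hpq F hqp hn : Subgroup (GL (Fin (m + 2)) F))) :=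
      Continuous.subtype_mk
        (continuous_subtype_val.comp (continuous_embP.comp continuous_subtype_val)) _
    have h1 := continuous_subtype_val.comp (χ.continuous.comp hj)
    have h2 : Continuous fun a : (mirabolic F m ⊓ Hpq' F hq hqp hn' :
        Subgroup (GL (Fin (m + 1)) F)) => rowModulus hq hqp hn' ⟨a.1, a.2.2⟩ :=
      (continuous_rowModulus hq hqp hn').comp (Continuous.subtype_mk continuous_subtype_val _)
    have h3 : Continuous fun a : (mirabolic F m ⊓ Hpq' F hq hqp hn' :
        Subgroup (GL (Fin (m + 1)) F)) => NNReal.sqrt (delta a.1) :=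
      NNReal.continuous_sqrt.comp (continuous_delta.comp continuous_subtype_val)
    refine Continuous.subtype_mk (h1.mul (NNReal.continuous_coe.comp (h2.div₀ h3 fun a => ?_))) _
    exact (NNReal.sqrt_pos.mpr (delta_pos _)).ne'

end Character

end GLDist

/-- `P_n` is `mirabolic F (m + 1)` and `P_{n-1}` is `mirabolic F m`, where `n = p + q = m + 2`. -/
theorem mainTheorem3 {F : Type*} [Field F] [ValuativeRel F] [TopologicalSpace F]
    [IsNonarchimedeanLocalField F]
    (θ : AddChar F ℂ) (hθc : Continuous θ) (hθ : θ ≠ 1)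
    (p q m : ℕ) (hq : 1 ≤ q) (hqp : q ≤ p) (hn : p + q = m + 2)
    {V : Type*} [AddCommGroup V] [Module ℂ V]
    (σ : Representation ℂ (mirabolic F m) V) (hσ : IsSmoothRep σ)
    (χ : PositiveCharacter
      (mirabolic F (m + 1) ⊓ Hpq F hqp hn : Subgroup (GL (Fin (m + 2)) F))) :
    ∃ χ' : PositiveCharacter
        (mirabolic F m ⊓ Hpq' F hq hqp (show p + (q - 1) = m + 1 by omega) :
          Subgroup (GL (Fin (m + 1)) F)),
      ∃ T : homChar (PhiPlus θ σ) (Hpq F hqp hn) χ →ₗ[ℂ]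
          homChar σ (Hpq' F hq hqp (show p + (q - 1) = m + 1 by omega)) χ',
        Function.Injective T := by
  have hn' : p + (q - 1) = m + 1 := by omega
  have hρ : IsSmoothRep (twistRep θ σ) := isSmoothRep_twistRep hθc hσ
  refine ⟨restrictedChar hq hqp hn hn' χ,
    { toFun := fun l => ⟨l.1 ∘ₗ ballMap hρ, fun a v => ?_⟩
      map_add' := fun _ _ => rfl
      map_smul' := fun _ _ => rfl }, ?_⟩
  · have h := homChar_ballMap_equivariant hθc hθ hq hn' hρ l.2 a.2.1 a.2.2 v
    have hs : (NNReal.sqrt (delta a.1) : ℂ) ≠ 0 := by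
      exact_mod_cast (NNReal.sqrt_pos.mpr (delta_pos a.1)).ne'
    -- The induction carries the factor `δ^{1/2}` in front of `σ`, which the denominator of
    -- `restrictedChar` cancels.
    refine mul_left_cancel₀ hs (h.trans ?_)
    change _ = _ * ((((χ ⟨embP a.1, (embP a.1).2, emb_mem_Hpq hq hqp hn hn' a.2.2⟩ :
      {x : ℝ // 0 < x}) : ℝ) *
      ((rowModulus hq hqp hn' ⟨a.1, a.2.2⟩ / NNReal.sqrt (delta a.1) : ℝ≥0) : ℝ) : ℝ) *
      l.1 (ballMap hρ v))
    rw [Complex.ofReal_mul, NNReal.coe_div, Complex.ofReal_div]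
    field_simp
  · rw [← LinearMap.ker_eq_bot, LinearMap.ker_eq_bot']
    intro l h0
    exact Subtype.ext (homChar_eq_zero_of_comp_ballMap hθc hθ hq hn' hρ l.2
      (congrArg Subtype.val h0))
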